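/- Partitions are denoted by $\lambda,\mu,\nu,\sigma,\tau$, and $s_\lambda=\{\lambda\}$ is the universal Schur function in countably many indeterminates $x=(x_1,x_2,\ldots)$, with integer coefficients. Let $c_{\lambda\mu}^\nu$ be the Littlewood–Richardson coefficients, $s_\lambda s_\mu=\sum_\nu c_{\lambda\mu}^\nu s_\nu$, and put $s_{\nu/\lambda}=\sum_\mu c_{\lambda\mu}^\nu s_\mu$. For a (possibly infinite) series of Schur functions $X=\sum_\sigma a_\sigma s_\sigma$ with $a_\sigma\in\mathbb Z$ put $\{\lambda/X\}=s_{\lambda/X}=\sum_\sigma a_\sigma s_{\lambda/\sigma}$ (a finite sum). Let $\Delta(X)=X(x,y)$ be the coproduct, that is, $X$ evaluated on the union of two alphabets $x$ and $y$, and write $f\otimes g$ for $f(x)g(y)$. Let $S$ and $T$ be series of Schur functions with $S\cdot T=1$, and for every partition $\lambda$ let $[\![\lambda]\!]=\{\lambda/S\}$ (these are the universal characters of the subgroup $H(n)$ of $GL(n)$ to which $S$ belongs). Extend this notation linearly: $[\![X]\!]=\sum_\nu a_\nu[\![\nu]\!]$ for a finite combination $X=\sum_\nu a_\nu s_\nu$.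 Let the integers $b_{\sigma\tau}$ be such that $$\Delta(T)=(T\otimes T)\cdot\sum_{\sigma,\tau}b_{\sigma\tau}\,s_\sigma\otimes s_\tau .$$ Then, for all partitions $\lambda,\mu$, $$[\![\lambda]\!]\cdot[\![\mu]\!]=\sum_{\sigma,\tau}b_{\sigma\tau}\,[\![(\lambda/\sigma)\cdot(\mu/\tau)]\!],$$ where $(\lambda/\sigma)\cdot(\mu/\tau)$ stands for $s_{\lambda/\sigma}\cdot s_{\mu/\tau}$ and only finitely many terms of the sum are nonzero. -/

import Mathlib

open scoped MvPowerSeries.WithPiTopology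

namespace SymmFn

/-! Symmetric functions in countably many indeterminates `x₀, x₁, …` are elements of
`MvPowerSeries ℕ ℤ`; infinite sums are taken for the coefficientwise (product) topology. Partitions
are Young diagrams. -/

/-- The alternant `|x_i ^ (e j)|` in the indeterminates `x₀, …, x_{n-1}`. -/
noncomputable def alternant (n : ℕ) (e : Fin n → ℕ) : MvPowerSeries (Fin n) ℤ :=
  (Matrix.of fun i j : Fin n => (MvPowerSeries.X i : MvPowerSeries (Fin n) ℤ) ^ e j).det

/-- The specialization `f(x₀, …, x_{n-1}, 0, 0, …)` of `f(x₀, x₁, …)`. -/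
noncomputable def restrict (n : ℕ) : MvPowerSeries ℕ ℤ →ₐ[ℤ] MvPowerSeries (Fin n) ℤ :=
  MvPowerSeries.killCompl Fin.valEmbedding

/-- `s` is the universal Schur function of the partition `l`: for every `n` not smaller than the
length of `l`, it specializes to the quotient `|x_i^(l_j + n - j)| / |x_i^(n - j)|`, that is (with
indices from `0` and `n - 1 - j = j.rev`) its product with the nonzero denominator is the numerator.
There is exactly one such `s`. -/
def IsSchurFunction (l : YoungDiagram) (s : MvPowerSeries ℕ ℤ) : Prop :=
  ∀ n : ℕ, l.colLen 0 ≤ n →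
    restrict n s * alternant n (fun j => (j.rev : ℕ)) =
      alternant n (fun j => l.rowLen j + (j.rev : ℕ))

/-- Complete homogeneous symmetric power series in the variables of `t` (auxiliary). -/
noncomputable def complete {ι : Type*} (t : Set ι) (k : ℕ) : MvPowerSeries ι ℤ :=
  open Classical in fun d => if d.degree = k ∧ (d.support : Set ι) ⊆ t then 1 else 0

open Classical in
theorem coeff_complete {ι : Type*} (t : Set ι) (k : ℕ) (d : ι →₀ ℕ) :
    MvPowerSeries.coeff d (complete t k) =
      if d.degree = k ∧ (d.support : Set ι) ⊆ t then 1 else 0 := rfl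

theorem complete_insert {ι : Type*} (t : Set ι) (i : ι) (hi : i ∉ t) :
    PowerSeries.mk (complete (insert i t)) *
      (1 - PowerSeries.C (MvPowerSeries.X i) * PowerSeries.X) = PowerSeries.mk (complete t) := by
  classical
  have key : ∀ d : ι →₀ ℕ, (d.support : Set ι) ⊆ t ↔ (d.support : Set ι) ⊆ insert i t ∧ d i = 0 := by
    intro d
    constructor
    · intro h
      refine ⟨h.trans (Set.subset_insert i t), ?_⟩
      by_contra h0
      exact hi (h (by simpa using h0))
    · rintro ⟨h, h0⟩ x hx
      rcases h hx with rfl | h'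
      · simp [h0] at hx
      · exact h'
  ext k d
  rw [mul_sub, mul_one, ← mul_assoc, map_sub, map_sub]
  rcases k with _ | k
  · simp only [PowerSeries.coeff_zero_mul_X, PowerSeries.coeff_mk, map_zero, sub_zero,
      coeff_complete, key d]
    by_cases hd : d = 0
    · simp [hd]
    · simp [Finsupp.degree_eq_zero_iff, hd]
  · rw [PowerSeries.coeff_succ_mul_X, PowerSeries.coeff_mul_C]
    simp only [PowerSeries.coeff_mk, coeff_complete, key d]
    by_cases h0 : d i = 0
    · have : MvPowerSeries.coeff d (complete (insert i t) k * MvPowerSeries.X i) = 0 := by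
        rw [MvPowerSeries.X, MvPowerSeries.coeff_mul_monomial, if_neg]
        simp [h0]
      simp [this, h0]
    · have hle : Finsupp.single i 1 ≤ d := by
        simpa [Nat.one_le_iff_ne_zero] using h0
      obtain ⟨d', rfl⟩ := exists_add_of_le hle
      rw [MvPowerSeries.X, MvPowerSeries.coeff_mul_monomial, if_pos hle]
      have hs : ((Finsupp.single i 1 + d').support : Set ι) ⊆ insert i t ↔
          (d'.support : Set ι) ⊆ insert i t := by
        constructor
        · intro h x hx
          exact h (by simp only [Finset.mem_coe, Finsupp.mem_support_iff, Finsupp.add_apply] at hx ⊢; omega)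
        · intro h x hx
          by_cases hxi : x = i
          · exact Or.inl hxi
          · exact h (by
              simpa [Finsupp.single_apply, Ne.symm hxi] using hx)
      have hdeg : (Finsupp.single i 1 + d').degree = k + 1 ↔ d'.degree = k := by
        rw [map_add, Finsupp.degree_single]; omega
      simp only [coeff_complete, hs, hdeg, add_tsub_cancel_left, mul_one, sub_self, h0, and_false,
        if_false]

theorem complete_compl {ι : Type*} [Fintype ι] [DecidableEq ι] (s : Finset ι) :
    PowerSeries.mk (complete (Set.univ : Set ι)) *
      (∏ i ∈ s, (1 - PowerSeries.C (MvPowerSeries.X i) * PowerSeries.X)) =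
      PowerSeries.mk (complete (s : Set ι)ᶜ) := by
  induction s using Finset.induction_on with
  | empty => simp
  | insert i s hi ih =>
    rw [Finset.prod_insert hi, mul_comm (1 - _), ← mul_assoc, ih]
    have : ((s : Set ι)ᶜ) = insert i ((insert i s : Finset ι) : Set ι)ᶜ := by
      ext x
      by_cases hx : x = i <;> simp [hx, hi]
    rw [this, complete_insert]
    simp

theorem complete_singleton {ι : Type*} (i : ι) (k : ℕ) :
    complete {i} k = (MvPowerSeries.X i : MvPowerSeries ι ℤ) ^ k := by
  classical
  ext d
  rw [coeff_complete, MvPowerSeries.coeff_X_pow]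
  congr 1
  simp only [eq_iff_iff]
  constructor
  · rintro ⟨h, hs⟩
    have : d = Finsupp.single i (d i) := by
      ext x
      by_cases hx : x = i
      · subst hx; simp
      · rw [Finsupp.single_apply, if_neg (Ne.symm hx)]
        by_contra h0
        exact hx (hs (by simpa using h0))
    rw [this, Finsupp.degree_single] at h
    rw [this, h]
  · rintro rfl
    refine ⟨Finsupp.degree_single _ _, ?_⟩
    intro x hx
    have := Finsupp.support_single_subset hx
    simpa using this

/-- The matrix of complete homogeneous series `h (l_j - j + i)` (auxiliary). -/
noncomputable def completeMatrix {ι : Type*} (l : YoungDiagram) (n : ℕ) :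
    Matrix (Fin n) (Fin n) (MvPowerSeries ι ℤ) :=
  Matrix.of fun i j =>
    if (j : ℕ) ≤ l.rowLen j + i then complete Set.univ (l.rowLen j + i - j) else 0

theorem alternant_factor (n : ℕ) : ∃ e : MvPowerSeries (Fin n) ℤ, ∀ l : YoungDiagram,
    alternant n (fun j => l.rowLen j + (j.rev : ℕ)) = e * (completeMatrix l n).det := by
  classical
  let P : Fin n → Polynomial (MvPowerSeries (Fin n) ℤ) := fun i =>
    ∏ j ∈ {i}ᶜ, (1 - Polynomial.C (MvPowerSeries.X j) * Polynomial.X)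
  have hP : ∀ i k, n ≤ k → (P i).coeff k = 0 := by
    intro i k hk
    apply Polynomial.coeff_eq_zero_of_natDegree_lt
    have h1 : (P i).natDegree ≤ ∑ j ∈ ({i}ᶜ : Finset (Fin n)), 1 := by
      refine (Polynomial.natDegree_prod_le _ _).trans (Finset.sum_le_sum fun j _ => ?_)
      compute_degree
    have h2 : ∑ j ∈ ({i}ᶜ : Finset (Fin n)), 1 = n - 1 := by simp [Finset.card_compl]
    have := i.pos
    omega
  have hpow : ∀ i m, (MvPowerSeries.X i : MvPowerSeries (Fin n) ℤ) ^ m =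
      ∑ k : Fin n, (P i).coeff k * (if (k : ℕ) ≤ m then complete Set.univ (m - k) else 0) := by
    intro i m
    have h := complete_compl ({i}ᶜ : Finset (Fin n))
    have h' := congrArg (PowerSeries.coeff m) h
    have hc : (({i}ᶜ : Finset (Fin n)) : Set (Fin n))ᶜ = {i} := by simp
    rw [hc, PowerSeries.coeff_mk, complete_singleton] at h'
    have hPs : (∏ j ∈ ({i}ᶜ : Finset (Fin n)), (1 - PowerSeries.C (MvPowerSeries.X j) *
        PowerSeries.X) : PowerSeries (MvPowerSeries (Fin n) ℤ)) = (P i : PowerSeries _) := by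
      simp only [P]
      rw [← Polynomial.coeToPowerSeries.ringHom_apply, map_prod]
      simp
    rw [hPs, mul_comm, PowerSeries.coeff_mul, Finset.Nat.sum_antidiagonal_eq_sum_range_succ_mk] at h'
    rw [← h', Fin.sum_univ_eq_sum_range
      (fun k => (P i).coeff k * (if k ≤ m then complete Set.univ (m - k) else 0)) n]
    simp only [Polynomial.coeff_coe, PowerSeries.coeff_mk]
    have e1 : ∑ k ∈ Finset.range (m + 1), (P i).coeff k * complete Set.univ (m - k) =
        ∑ k ∈ Finset.range (m + 1 + n), (P i).coeff k *
          (if k ≤ m then complete Set.univ (m - k) else 0) := by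
      rw [← Finset.sum_subset (Finset.range_mono (Nat.le_add_right (m + 1) n))]
      · refine Finset.sum_congr rfl fun k hk => ?_
        rw [if_pos (by simpa [Nat.lt_succ_iff] using hk)]
      · intro k _ hk
        rw [if_neg (by simpa [Nat.lt_succ_iff] using hk), mul_zero]
    rw [e1]
    symm
    apply Finset.sum_subset (Finset.range_mono (by omega))
    intro k _ hk
    rw [hP i k (by simpa using hk), zero_mul]
  refine ⟨(Matrix.of fun i k : Fin n => (P i).coeff (k.rev : ℕ)).det, fun l => ?_⟩
  rw [← Matrix.det_mul, alternant]
  congr 1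
  ext1 i j
  rw [Matrix.of_apply, hpow, Matrix.mul_apply, ← Equiv.sum_comp Fin.revPerm]
  refine Finset.sum_congr rfl fun k _ => ?_
  simp only [Fin.revPerm_apply, Matrix.of_apply, completeMatrix, Fin.val_rev]
  congr 1
  have h1 := k.isLt
  have h2 := j.isLt
  by_cases h : (j : ℕ) ≤ l.rowLen j + k
  · rw [if_pos h, if_pos (by omega)]
    congr 1
    omega
  · rw [if_neg h, if_neg (by omega)]

theorem complete_zero {ι : Type*} : complete (Set.univ : Set ι) 0 = 1 := by
  classical
  ext d
  rw [coeff_complete, MvPowerSeries.coeff_one]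
  simp [Finsupp.degree_eq_zero_iff]

theorem completeMatrix_det {ι : Type*} (l : YoungDiagram) (n : ℕ) (h : l.colLen 0 ≤ n) :
    (completeMatrix (ι := ι) l n).det = (completeMatrix (ι := ι) l (l.colLen 0)).det := by
  induction n, h using Nat.le_induction with
  | base => rfl
  | succ n hn ih =>
    have hrow : l.rowLen n = 0 := by
      by_contra h0
      have h1 : (n, 0) ∈ l := YoungDiagram.mem_iff_lt_rowLen.2 (Nat.pos_of_ne_zero h0)
      have h2 := YoungDiagram.mem_iff_lt_colLen.1 h1
      omega
    rw [Matrix.det_succ_column _ (Fin.last n), Finset.sum_eq_single (Fin.last n)]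
    · rw [← ih]
      have hs : (completeMatrix (ι := ι) l (n + 1)).submatrix (Fin.last n).succAbove
          (Fin.last n).succAbove = completeMatrix l n := by
        ext1 i j
        simp [completeMatrix]
      rw [hs]
      simp [completeMatrix, hrow, complete_zero]
    · intro i _ hi
      have : (i : ℕ) < n := Fin.val_lt_last hi
      simp [completeMatrix, hrow, this]
    · simp

theorem restrict_complete (n k : ℕ) : restrict n (complete Set.univ k) = complete Set.univ k := by
  classical
  ext d
  rw [restrict, MvPowerSeries.coeff_killCompl, coeff_complete, coeff_complete]
  have : (Finsupp.embDomain Fin.valEmbedding d).degree = d.degree := by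
    change ∑ i ∈ (Finsupp.embDomain Fin.valEmbedding d).support, _ = ∑ i ∈ d.support, d i
    rw [Finsupp.support_embDomain, Finset.sum_map]
    simp only [Finsupp.embDomain_apply_self]
  simp [this]

theorem exists_isSchurFunction (l : YoungDiagram) : ∃ s, IsSchurFunction l s := by
  refine ⟨(completeMatrix l (l.colLen 0)).det, fun n hn => ?_⟩
  obtain ⟨e, he⟩ := alternant_factor n
  have hc : (⊥ : YoungDiagram).colLen 0 = 0 := by
    by_contra h
    exact YoungDiagram.notMem_bot _ (YoungDiagram.mem_iff_lt_colLen.2 (Nat.pos_of_ne_zero h))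
  have hb : ∀ j, (⊥ : YoungDiagram).rowLen j = 0 := by
    intro j
    by_contra h
    exact YoungDiagram.notMem_bot _ (YoungDiagram.mem_iff_lt_rowLen.2 (Nat.pos_of_ne_zero h))
  have h0 : (completeMatrix (ι := Fin n) ⊥ n).det = 1 := by
    rw [completeMatrix_det ⊥ n (by omega), hc]
    simp
  have h1 := he ⊥
  simp only [hb, zero_add, h0, mul_one] at h1
  have h2 : restrict n (completeMatrix l (l.colLen 0)).det =
      (completeMatrix (ι := Fin n) l n).det := by
    rw [completeMatrix_det l n hn, AlgHom.map_det]
    congr 1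
    ext1 i j
    simp only [completeMatrix, AlgHom.mapMatrix_apply, Matrix.map_apply, Matrix.of_apply]
    split_ifs
    · exact restrict_complete _ _
    · exact map_zero _
  rw [h1, h2, he l, mul_comm]

/-- The universal Schur function `s_l(x)`, also written `{l}`. -/
noncomputable def schur (l : YoungDiagram) : MvPowerSeries ℕ ℤ :=
  (exists_isSchurFunction l).choose

/-- `X` is a (possibly infinite) series of Schur functions with integer coefficients. -/
def IsSchurSeries (X : MvPowerSeries ℕ ℤ) : Prop :=
  ∃ a : YoungDiagram → ℤ, HasSum (fun s => a s • schur s) X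

open Classical in
/-- The coefficient `(X | s_s)` of `s_s` in the expansion of `X` as a series of Schur functions
(such an expansion is unique; the value is `0` if `X` is not a series of Schur functions). -/
noncomputable def schurCoeff (X : MvPowerSeries ℕ ℤ) (s : YoungDiagram) : ℤ :=
  if h : IsSchurSeries X then h.choose s else 0

/-- The Littlewood-Richardson coefficient `c_{l m}^v`: the coefficient of `s_v` in `s_l s_m`. -/
noncomputable def lrCoeff (l m v : YoungDiagram) : ℤ :=
  schurCoeff (schur l * schur m) v

/-- The skew Schur function `s_{v/l} = ∑_m c_{l m}^v s_m` (a finite sum). -/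
noncomputable def skewSchur (v l : YoungDiagram) : MvPowerSeries ℕ ℤ :=
  ∑ᶠ m, lrCoeff l m v • schur m

/-- `s_{l/X} = ∑_s a_s s_{l/s}` for a series `X = ∑_s a_s s_s` (a finite sum). -/
noncomputable def skewBy (l : YoungDiagram) (X : MvPowerSeries ℕ ℤ) : MvPowerSeries ℕ ℤ :=
  ∑ᶠ s, schurCoeff X s • skewSchur l s

/-- The universal character `[[l]] = {l/S}` attached to the series `S`. -/
noncomputable def univChar (S : MvPowerSeries ℕ ℤ) (l : YoungDiagram) : MvPowerSeries ℕ ℤ :=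
  skewBy l S

/-- The linear extension `[[X]] = ∑_v a_v [[v]]` for a finite combination `X = ∑_v a_v s_v`. -/
noncomputable def univCharLin (S X : MvPowerSeries ℕ ℤ) : MvPowerSeries ℕ ℤ :=
  ∑ᶠ v, schurCoeff X v • univChar S v

/-- `f ⊗ g = f(x) g(y)`, in two alphabets `x_i = X (inl i)` and `y_i = X (inr i)`. -/
noncomputable def tensor (f g : MvPowerSeries ℕ ℤ) : MvPowerSeries (ℕ ⊕ ℕ) ℤ :=
  MvPowerSeries.rename Function.Embedding.inl f *
    MvPowerSeries.rename Function.Embedding.inr g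

/-- The coproduct `Δ(f) = f(x, y)`: the symmetric function `f` of the union of two alphabets (by
symmetry, it does not matter in which order the union is enumerated). -/
noncomputable def coproduct (f : MvPowerSeries ℕ ℤ) : MvPowerSeries (ℕ ⊕ ℕ) ℤ :=
  MvPowerSeries.renameEquiv ℤ Equiv.natSumNatEquivNat.symm f

end SymmFn

/-!
The statement is Hopf-algebraic: for the pairing `⟨-, -⟩` in which Schur functions are orthonormal,
skewing by `X` is the adjoint of multiplication by `X` (`pairing_skew`), and multiplication is the
adjoint of the coproduct, `⟨Y, f g⟩ = ⟨Δ(Y), f ⊗ g⟩` (`pairing_combMul`). Hence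
`⟨Y, ((f/S) (g/S))/T⟩ = ⟨Δ(T) Δ(Y), f/S ⊗ g/S⟩ = ⟨(S ⊗ S) (T ⊗ T) D Δ(Y), f ⊗ g⟩`, and since
`S T = 1` this is `⟨D Δ(Y), f ⊗ g⟩ = ∑ b_{στ} ⟨Y, (f/σ) (g/τ)⟩`. So skewing `(f/S) (g/S)` by `T`
gives `∑ b_{στ} (f/σ) (g/τ)` (`skew_combMul_skew`), and skewing by `S = T⁻¹` gives the claim.

The pairing is made concrete by the functional `f ↦ ∑ p, sign p * [x^(l + δ - p δ)] f`
(`schurFunctional`), which is continuous and, by the definition of Schur functions through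
alternants, dual to them (`schurFunctional_schur`). It has the shape of the Jacobi–Trudi formula
`s_l = ∑ p, sign p * h_{l + δ - p δ}` (`schur_eq_sum`), so that the self-duality
`(s_l s_m | s_v) = (s_l ⊗ s_m | Δ(s_v))` (`schurFunctional_schur_mul_schur`) comes down to the
symmetry `[x^b] h_a = [x^a] h_b` (`coeff_completeProd_comm`), where the entries of `b` are indexed
by two alphabets: both sides count the matrices of natural numbers with row sums `a` and column
sums `b`.

That every symmetric power series is a series of Schur functions (`hasSum_schurFunctional`), which
makes the coefficients of products meaningful, rests on `eq_zero_of_schurFunctional_eq_zero`: if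
`x^d` has maximal `∑ d_i²` among the monomials of its degree in `f ≠ 0`, and `l` is `d` sorted, then
by the rearrangement inequality every term but `[x^l] f` of the functional of `l` vanishes.
-/

namespace SymmFn

open MvPowerSeries Equiv

/-! ### Alternants and the Jacobi–Trudi formula -/

theorem rowLen_eq_zero {l : YoungDiagram} {n : ℕ} (h : l.colLen 0 ≤ n) : l.rowLen n = 0 := by
  by_contra h0
  have h1 : (n, 0) ∈ l := YoungDiagram.mem_iff_lt_rowLen.2 (Nat.pos_of_ne_zero h0)
  have h2 := YoungDiagram.mem_iff_lt_colLen.1 h1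
  omega

/-- The exponent `d : ℕ →₀ ℕ` with `d i = e i` for `i < n`, and `0` beyond. -/
noncomputable def extendZero {n : ℕ} (e : Fin n → ℕ) : ℕ →₀ ℕ :=
  (Finsupp.equivFunOnFinite.symm e).embDomain Fin.valEmbedding

theorem extendZero_apply {n : ℕ} (e : Fin n → ℕ) (i : Fin n) : extendZero e i = e i :=
  Finsupp.embDomain_apply_self Fin.valEmbedding _ i

theorem extendZero_of_le {n : ℕ} (e : Fin n → ℕ) {i : ℕ} (hi : n ≤ i) : extendZero e i = 0 :=
  Finsupp.embDomain_of_notMem_range _ _ _ fun ⟨j, hj⟩ => by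
    have := j.isLt; simp at hj; omega

theorem sum_extendZero {M : Type*} [AddCommMonoid M] {n : ℕ} (e : Fin n → ℕ) (g : ℕ → M)
    (hg : g 0 = 0) : (extendZero e).sum (fun _ k => g k) = ∑ i, g (e i) := by
  rw [extendZero, Finsupp.sum_embDomain, Finsupp.sum_fintype _ _ fun _ => hg]
  rfl

theorem exists_eq_extendZero (d : ℕ →₀ ℕ) {n : ℕ} (h : ∀ i, n ≤ i → d i = 0) :
    d = extendZero fun i : Fin n => d i := by
  ext i
  rcases lt_or_ge i n with hi | hi
  · exact (extendZero_apply (fun i : Fin n => d i) ⟨i, hi⟩).symm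
  · rw [h i hi, extendZero_of_le _ hi]

/-- A power series in countably many variables is determined by its restrictions to the first `n`
variables, for all large `n`. -/
theorem restrict_ext {f g : MvPowerSeries ℕ ℤ} (N : ℕ)
    (h : ∀ n, N ≤ n → restrict n f = restrict n g) : f = g := by
  ext d
  obtain ⟨M, hM⟩ := d.support.exists_nat_subset_range
  have hd : d = extendZero fun i : Fin (max N M) => d i := by
    refine exists_eq_extendZero d fun i hi => ?_
    by_contra h0
    have := Finset.mem_range.1 (hM (Finsupp.mem_support_iff.2 h0))
    omega
  have := congrArg (coeff (Finsupp.equivFunOnFinite.symm fun i : Fin (max N M) => d i))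
    (h (max N M) (le_max_left _ _))
  rw [restrict, coeff_killCompl, coeff_killCompl] at this
  rw [hd]
  exact this

theorem alternant_eq_sum (n : ℕ) (e : Fin n → ℕ) : alternant n e =
    ∑ p : Perm (Fin n), (Perm.sign p : ℤ) •
      monomial (Finsupp.equivFunOnFinite.symm fun i => e (p i)) (1 : ℤ) := by
  rw [alternant, ← Matrix.det_transpose, Matrix.det_apply]
  refine Finset.sum_congr rfl fun p _ => ?_
  rw [Units.smul_def]
  congr 1
  rw [monomial_one_eq, Finsupp.prod_fintype _ _ (by simp)]
  rfl

/-- Two strictly decreasing exponents are permutations of each other only if they are equal, so an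
alternant contains exactly one monomial with a strictly decreasing exponent. -/
theorem coeff_alternant {n : ℕ} {e e' : Fin n → ℕ} (he : StrictAnti e) (he' : StrictAnti e') :
    coeff (Finsupp.equivFunOnFinite.symm e') (alternant n e) = if e' = e then 1 else 0 := by
  classical
  have key : ∀ p : Perm (Fin n), (e' = fun i => e (p i)) ↔ (p = 1 ∧ e' = e) := by
    intro p
    constructor
    · intro h
      have hp : StrictMono p := fun i j hij => by
        have := he' hij
        rw [h] at this
        exact he.lt_iff_gt.1 this
      have : p = 1 := by
        -- the identity is the only order automorphism of `Fin n`
        have h1 : hp.orderIsoOfSurjective p p.surjective = OrderIso.refl _ :=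
          Subsingleton.elim _ _
        ext i
        exact congrArg Fin.val (DFunLike.congr_fun h1 i)
      subst this
      exact ⟨rfl, h⟩
    · rintro ⟨rfl, rfl⟩
      rfl
  rw [alternant_eq_sum, map_sum, Finset.sum_eq_single 1]
  · simp [coeff_monomial]
  · intro p _ hp
    rw [map_smul, coeff_monomial, if_neg, smul_zero]
    intro h
    exact hp ((key p).1 (Finsupp.equivFunOnFinite.symm.injective h)).1
  · simp

theorem strictAnti_shift (n : ℕ) (l : YoungDiagram) :
    StrictAnti fun j : Fin n => l.rowLen j + (j.rev : ℕ) := by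
  intro i j hij
  have h1 := l.rowLen_anti i j (by exact_mod_cast hij.le)
  have : (i : ℕ) < j := hij
  have := j.isLt
  simp only [Fin.val_rev]
  omega

theorem strictAnti_rev (n : ℕ) : StrictAnti fun j : Fin n => (j.rev : ℕ) := by
  intro i j hij
  have : (i : ℕ) < j := hij
  have := j.isLt
  simp only [Fin.val_rev]
  omega

theorem alternant_rev_ne_zero (n : ℕ) : alternant n (fun j => (j.rev : ℕ)) ≠ 0 := by
  intro h
  have := coeff_alternant (strictAnti_rev n) (strictAnti_rev n)
  rw [h] at this
  simp at this

theorem IsSchurFunction.unique {l : YoungDiagram} {s t : MvPowerSeries ℕ ℤ}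
    (hs : IsSchurFunction l s) (ht : IsSchurFunction l t) : s = t :=
  restrict_ext (l.colLen 0) fun n hn =>
    mul_right_cancel₀ (alternant_rev_ne_zero n) ((hs n hn).trans (ht n hn).symm)

theorem isSchurFunction_schur (l : YoungDiagram) : IsSchurFunction l (schur l) :=
  (exists_isSchurFunction l).choose_spec

/-- By `alternant_factor`, applied to `l` and to the empty partition, the quotient of the two
alternants is a Jacobi–Trudi determinant. -/
theorem isSchurFunction_det (l : YoungDiagram) :
    IsSchurFunction l (completeMatrix l (l.colLen 0)).det := by
  intro n hn
  obtain ⟨e, he⟩ := alternant_factor n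
  -- the factor `e` is the denominator: take the empty partition
  have hc : (⊥ : YoungDiagram).colLen 0 = 0 := by
    by_contra h
    exact YoungDiagram.notMem_bot _ (YoungDiagram.mem_iff_lt_colLen.2 (Nat.pos_of_ne_zero h))
  have hb : ∀ j, (⊥ : YoungDiagram).rowLen j = 0 := fun j => rowLen_eq_zero (by omega)
  have h0 : (completeMatrix (ι := Fin n) ⊥ n).det = 1 := by
    rw [completeMatrix_det ⊥ n (by omega), hc]
    simp
  have h1 := he ⊥
  simp only [hb, zero_add, h0, mul_one] at h1
  have h2 : restrict n (completeMatrix l (l.colLen 0)).det =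
      (completeMatrix (ι := Fin n) l n).det := by
    rw [completeMatrix_det l n hn, AlgHom.map_det]
    congr 1
    ext1 i j
    simp only [completeMatrix, AlgHom.mapMatrix_apply, Matrix.map_apply, Matrix.of_apply]
    split_ifs
    · exact restrict_complete _ _
    · exact map_zero _
  rw [h1, h2, he l, mul_comm]

/-- The Jacobi–Trudi formula, for every `n` not smaller than the length of `l`. -/
theorem schur_eq_det (l : YoungDiagram) {n : ℕ} (hn : l.colLen 0 ≤ n) :
    schur l = (completeMatrix l n).det := by
  rw [completeMatrix_det l n hn]
  exact (isSchurFunction_schur l).unique (isSchurFunction_det l)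

/-- The product `h_a = ∏ i, h_(a i)` of complete homogeneous series in the variables indexed by
`κ`. -/
noncomputable def completeProd {ι : Type*} (κ : Type*) (a : ι →₀ ℕ) : MvPowerSeries κ ℤ :=
  a.prod fun _ k => complete Set.univ k

/-- The permutations `p` of `0, …, n-1` for which `l + δ - p δ` has no negative entry; these
index the terms of the Jacobi–Trudi determinant that are not `0`. -/
def jacobiPerms (n : ℕ) (l : YoungDiagram) : Finset (Perm (Fin n)) :=
  Finset.univ.filter fun p => ∀ j : Fin n, (j : ℕ) ≤ l.rowLen j + p j

/-- The exponent `l + δ - p δ`, whose entries are `l_j - j + p j` for `j < n`. -/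
noncomputable def jacobiExp {n : ℕ} (l : YoungDiagram) (p : Perm (Fin n)) : ℕ →₀ ℕ :=
  extendZero fun j : Fin n => l.rowLen j + p j - j

theorem schur_eq_sum (l : YoungDiagram) {n : ℕ} (hn : l.colLen 0 ≤ n) :
    schur l = ∑ p ∈ jacobiPerms n l, (Perm.sign p : ℤ) • completeProd ℕ (jacobiExp l p) := by
  rw [schur_eq_det l hn, Matrix.det_apply, jacobiPerms, Finset.sum_filter]
  refine Finset.sum_congr rfl fun p _ => ?_
  rw [Units.smul_def]
  split_ifs with h
  · congr 1
    rw [completeProd, jacobiExp, extendZero, Finsupp.prod_embDomain,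
      Finsupp.prod_fintype _ _ fun _ => complete_zero]
    refine Finset.prod_congr rfl fun j _ => ?_
    simp [completeMatrix, h j]
  · push Not at h
    obtain ⟨j, hj⟩ := h
    rw [Finset.prod_eq_zero (Finset.mem_univ j), smul_zero]
    simp [completeMatrix, hj]

/-- The coefficient of `x^(l + δ)` in `f(x_0, …, x_{n-1})` times the alternant of `δ`. -/
theorem coeff_restrict_mul_alternant (n : ℕ) (l : YoungDiagram) (f : MvPowerSeries ℕ ℤ) :
    coeff (Finsupp.equivFunOnFinite.symm fun j : Fin n => l.rowLen j + (j.rev : ℕ))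
        (restrict n f * alternant n fun j => (j.rev : ℕ)) =
      ∑ p ∈ jacobiPerms n l, (Perm.sign p : ℤ) * coeff (jacobiExp l p) f := by
  classical
  rw [alternant_eq_sum, Finset.mul_sum, map_sum, jacobiPerms, Finset.sum_filter]
  refine Finset.sum_congr rfl fun p _ => ?_
  rw [mul_smul_comm, map_smul, coeff_mul_monomial, smul_eq_mul, mul_one]
  have hle : ((Finsupp.equivFunOnFinite.symm fun i : Fin n => ((p i).rev : ℕ)) ≤
      Finsupp.equivFunOnFinite.symm fun j : Fin n => l.rowLen j + (j.rev : ℕ)) ↔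
      ∀ j : Fin n, (j : ℕ) ≤ l.rowLen j + p j := by
    rw [Finsupp.le_def]
    refine forall_congr' fun j => ?_
    have := j.isLt
    have := (p j).isLt
    simp only [Finsupp.equivFunOnFinite_symm_apply_apply, Fin.val_rev]
    omega
  rw [if_congr hle rfl rfl, mul_ite, mul_zero]
  congr 2
  rw [restrict, coeff_killCompl, jacobiExp, extendZero]
  congr 2
  congr 1
  ext j
  have := j.isLt
  have := (p j).isLt
  simp only [Finsupp.equivFunOnFinite_symm_apply_apply, Fin.val_rev, Finsupp.tsub_apply]
  omega

/-! ### Products of complete functions, and exponents of partitions -/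

theorem coeff_completeProd {ι κ : Type*} (a : ι →₀ ℕ) (b : κ →₀ ℕ) :
    coeff b (completeProd κ a) =
      Nat.card {M : ι →₀ κ →₀ ℕ // (∀ i, (M i).degree = a i) ∧ M.sum (fun _ r => r) = b} := by
  classical
  have h1 : coeff b (completeProd κ a) =
      ((Finset.finsuppAntidiag a.support b).filter fun M : ι →₀ κ →₀ ℕ =>
        ∀ i ∈ a.support, (M i).degree = a i).card := by
    rw [completeProd, Finsupp.prod, coeff_prod, Finset.card_filter, Nat.cast_sum]
    refine Finset.sum_congr rfl fun M _ => ?_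
    simp only [coeff_complete, Set.subset_univ, and_true, Finset.prod_ite_zero,
      Finset.prod_const_one]
    push_cast
    rfl
  rw [h1, Nat.cast_inj, ← Nat.card_eq_finsetCard]
  refine Nat.card_congr (Equiv.subtypeEquivRight fun M => ?_)
  rw [Finset.mem_filter, Finset.mem_finsuppAntidiag, iff_comm]
  constructor
  · rintro ⟨h, rfl⟩
    have hs : M.support ⊆ a.support := by
      intro i hi
      rw [Finsupp.mem_support_iff, ← h i]
      rw [Finsupp.mem_support_iff] at hi
      exact fun h0 => hi ((Finsupp.degree_eq_zero_iff _).1 h0)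
    exact ⟨⟨(Finsupp.sum_of_support_subset _ hs (fun _ r => r) fun _ _ => rfl).symm, hs⟩,
      fun i _ => h i⟩
  · rintro ⟨⟨rfl, hs⟩, h⟩
    refine ⟨fun i => ?_, Finsupp.sum_of_support_subset _ hs _ fun _ _ => rfl⟩
    by_cases hi : i ∈ a.support
    · exact h i hi
    · rw [Finsupp.notMem_support_iff.1 hi, Finsupp.notMem_support_iff.1 fun h' => hi (hs h'),
        map_zero]

/-- The coefficient of `x^b` in `h_a` is the coefficient of `x^a` in `h_b`: both count the matrices
of natural numbers with row sums `a` and column sums `b`. -/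
theorem coeff_completeProd_comm {ι κ : Type*} (a : ι →₀ ℕ) (b : κ →₀ ℕ) :
    coeff b (completeProd κ a) = coeff a (completeProd ι b) := by
  classical
  rw [coeff_completeProd, coeff_completeProd, Nat.cast_inj]
  -- transposition of matrices
  let e (ι κ : Type _) : (ι →₀ κ →₀ ℕ) ≃ (κ →₀ ι →₀ ℕ) :=
    Finsupp.curryEquiv.symm.trans
      ((Finsupp.equivCongrLeft (Equiv.prodComm ι κ)).trans Finsupp.curryEquiv)
  have he : ∀ M i k, e ι κ M k i = M i k := fun M i k => rfl
  have hsum : ∀ M : ι →₀ κ →₀ ℕ, ∀ k, (M.sum fun _ r => r) k = (e ι κ M k).degree := by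
    intro M k
    rw [Finsupp.sum_apply, Finsupp.degree_apply]
    change M.sum (fun i r => r k) = (e ι κ M k).sum fun _ r => r
    rw [Finsupp.sum, Finsupp.sum_of_support_subset _ (s := M.support) _ _ fun _ _ => rfl]
    · rfl
    · intro i hi
      rw [Finsupp.mem_support_iff, he] at hi
      rw [Finsupp.mem_support_iff]
      intro h
      rw [h] at hi
      exact hi rfl
  have hsum' : ∀ M : ι →₀ κ →₀ ℕ, ∀ i, (M i).degree = ((e ι κ M).sum fun _ r => r) i := by
    intro M i
    rw [Finsupp.sum_apply, Finsupp.degree_apply]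
    change (M i).sum (fun _ r => r) = (e ι κ M).sum fun k r => r i
    rw [Finsupp.sum_of_support_subset _ (s := (e ι κ M).support) _ _ fun _ _ => rfl]
    · rfl
    · intro k hk
      rw [Finsupp.mem_support_iff, ← he M] at hk
      rw [Finsupp.mem_support_iff]
      intro h
      rw [h] at hk
      exact hk rfl
  refine Nat.card_congr ((e ι κ).subtypeEquiv fun M => ?_)
  rw [and_comm, DFunLike.ext_iff, DFunLike.ext_iff]
  simp only [hsum, hsum']

/-- `h_a` is homogeneous. -/
theorem degree_eq_of_coeff_completeProd_ne_zero {ι κ : Type*} {a : ι →₀ ℕ} {b : κ →₀ ℕ}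
    (h : coeff b (completeProd κ a) ≠ 0) : b.degree = a.degree := by
  classical
  rw [completeProd, Finsupp.prod, coeff_prod] at h
  obtain ⟨M, hM, h⟩ := Finset.exists_ne_zero_of_sum_ne_zero h
  rw [← (Finset.mem_finsuppAntidiag.1 hM).1, map_sum, Finsupp.degree_apply]
  refine Finset.sum_congr rfl fun i hi => ?_
  have := Finset.prod_ne_zero_iff.1 h i hi
  rw [coeff_complete] at this
  by_contra h'
  simp [h'] at this

/-- The exponent `(l_0, l_1, …)` of the parts of `l`. -/
noncomputable def parts (l : YoungDiagram) : ℕ →₀ ℕ :=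
  extendZero fun j : Fin (l.colLen 0) => l.rowLen j

theorem parts_apply (l : YoungDiagram) (i : ℕ) : parts l i = l.rowLen i := by
  rcases lt_or_ge i (l.colLen 0) with h | h
  · exact extendZero_apply (fun j : Fin (l.colLen 0) => l.rowLen j) ⟨i, h⟩
  · rw [rowLen_eq_zero h, parts, extendZero_of_le _ h]

/-- The weight `|l|` of the partition `l`. -/
noncomputable def weight (l : YoungDiagram) : ℕ := (parts l).degree

theorem degree_jacobiExp {l : YoungDiagram} {p : Perm (Fin (l.colLen 0))}
    (hp : p ∈ jacobiPerms (l.colLen 0) l) : (jacobiExp l p).degree = weight l := by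
  have h1 : ∀ {n : ℕ} (e : Fin n → ℕ), (extendZero e).degree = ∑ i, e i := fun e =>
    sum_extendZero e id rfl
  rw [weight, jacobiExp, parts, h1, h1]
  have hp' := (Finset.mem_filter.1 hp).2
  have h2 : ∑ j : Fin (l.colLen 0), (l.rowLen j + p j - j) + ∑ j : Fin (l.colLen 0), (j : ℕ) =
      ∑ j : Fin (l.colLen 0), l.rowLen j + ∑ j : Fin (l.colLen 0), (j : ℕ) := by
    rw [← Equiv.sum_comp p fun j : Fin (l.colLen 0) => (j : ℕ)]
    conv_lhs => rw [Equiv.sum_comp p fun j : Fin (l.colLen 0) => (j : ℕ)]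
    rw [← Finset.sum_add_distrib, ← Finset.sum_add_distrib]
    refine Finset.sum_congr rfl fun j _ => ?_
    have := hp' j
    omega
  omega

/-- The sum of the squares of the entries of an exponent. -/
noncomputable def sumSq (d : ℕ →₀ ℕ) : ℕ := d.sum fun _ k => k ^ 2

theorem sumSq_le (d : ℕ →₀ ℕ) : sumSq d ≤ d.degree ^ 2 :=
  Finset.sum_sq_le_sq_sum_of_nonneg fun _ _ => Nat.zero_le _

/-- `‖l + δ - p δ‖² = ‖l‖² + 2 ⟨l, δ - p δ⟩ + ‖δ - p δ‖²`, where the middle term is nonnegative by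
the rearrangement inequality. -/
theorem sumSq_lt_sumSq_jacobiExp {l : YoungDiagram} {p : Perm (Fin (l.colLen 0))}
    (hp : p ∈ jacobiPerms (l.colLen 0) l) (h1 : p ≠ 1) :
    sumSq (parts l) < sumSq (jacobiExp l p) := by
  have hp' := (Finset.mem_filter.1 hp).2
  rw [sumSq, sumSq, parts, jacobiExp, sum_extendZero _ (fun k => k ^ 2) (by simp),
    sum_extendZero _ (fun k => k ^ 2) (by simp)]
  have hrow : Antivary (fun j : Fin (l.colLen 0) => (l.rowLen j : ℤ))
      fun j : Fin (l.colLen 0) => (j : ℤ) := by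
    intro i j hij
    have h : (i : ℕ) < j := by simpa using hij
    simpa using l.rowLen_anti i j h.le
  have h2 := hrow.sum_mul_le_sum_mul_comp_perm (σ := p)
  have h3 : 0 < ∑ j : Fin (l.colLen 0), ((p j : ℤ) - j) ^ 2 := by
    obtain ⟨j, hj⟩ : ∃ j, p j ≠ j := by
      by_contra! h
      exact h1 (Equiv.ext h)
    refine Finset.sum_pos' (fun _ _ => sq_nonneg _) ⟨j, Finset.mem_univ _, ?_⟩
    have : ((p j : ℕ) : ℤ) - j ≠ 0 := by
      rw [sub_ne_zero]
      exact_mod_cast fun h => hj (Fin.ext h)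
    positivity
  have h4 : ((∑ j : Fin (l.colLen 0), (l.rowLen j + p j - j) ^ 2 : ℕ) : ℤ) =
      ∑ j : Fin (l.colLen 0), (l.rowLen j : ℤ) ^ 2 + 2 *
        (∑ j : Fin (l.colLen 0), (l.rowLen j : ℤ) * (p j : ℤ) -
          ∑ j : Fin (l.colLen 0), (l.rowLen j : ℤ) * (j : ℤ)) +
        ∑ j : Fin (l.colLen 0), ((p j : ℤ) - j) ^ 2 := by
    rw [← Finset.sum_sub_distrib, Finset.mul_sum, ← Finset.sum_add_distrib,
      ← Finset.sum_add_distrib, Nat.cast_sum]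
    refine Finset.sum_congr rfl fun j _ => ?_
    rw [Nat.cast_pow, Nat.cast_sub (hp' j)]
    push_cast
    ring
  have h5 : ((∑ j : Fin (l.colLen 0), l.rowLen j ^ 2 : ℕ) : ℤ) =
      ∑ j : Fin (l.colLen 0), (l.rowLen j : ℤ) ^ 2 := by push_cast; rfl
  have h6 : ((∑ j : Fin (l.colLen 0), l.rowLen j ^ 2 : ℕ) : ℤ) <
      ((∑ j : Fin (l.colLen 0), (l.rowLen j + p j - j) ^ 2 : ℕ) : ℤ) := by
    rw [h4, h5]
    linarith
  exact_mod_cast h6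

theorem parts_injective : Function.Injective parts := by
  intro l m h
  ext ⟨i, j⟩
  rw [YoungDiagram.mem_cells, YoungDiagram.mem_cells, YoungDiagram.mem_iff_lt_rowLen,
    YoungDiagram.mem_iff_lt_rowLen, ← parts_apply, ← parts_apply, h]

theorem finite_weight_le (N : ℕ) : {l : YoungDiagram | weight l ≤ N}.Finite := by
  have hinj : Function.Injective YoungDiagram.cells := fun l m h => by
    ext1; exact h
  refine Set.Finite.of_finite_image (f := YoungDiagram.cells) ?_ hinj.injOn
  refine ((Finset.range (N + 1) ×ˢ Finset.range (N + 1)).powerset.finite_toSet).subset ?_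
  rintro _ ⟨l, hl, rfl⟩
  rw [Finset.mem_coe, Finset.mem_powerset]
  rintro ⟨i, j⟩ hij
  have hj := YoungDiagram.mem_iff_lt_rowLen.1 ((YoungDiagram.mem_cells _).1 hij)
  have h1 : weight l = ∑ i : Fin (l.colLen 0), l.rowLen i := sum_extendZero _ id rfl
  have hi : i < l.colLen 0 := by
    by_contra h
    rw [rowLen_eq_zero (not_lt.1 h)] at hj
    omega
  have h2 : l.rowLen i ≤ weight l := by
    rw [h1]
    exact Finset.single_le_sum (f := fun i : Fin (l.colLen 0) => l.rowLen i)
      (fun _ _ => Nat.zero_le _) (Finset.mem_univ ⟨i, hi⟩)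
  have h3 : l.colLen 0 ≤ weight l := by
    rw [h1]
    calc l.colLen 0 = ∑ i : Fin (l.colLen 0), 1 := by simp
      _ ≤ _ := Finset.sum_le_sum fun i _ => by
        have := YoungDiagram.mem_iff_lt_rowLen.1 (YoungDiagram.mem_iff_lt_colLen.2 i.isLt)
        omega
  have hl' : weight l ≤ N := hl
  rw [Finset.mem_product, Finset.mem_range, Finset.mem_range]
  constructor <;> simp only <;> omega

theorem exists_parts_eq {a : ℕ → ℕ} (ha : Antitone a) {N : ℕ} (hN : ∀ i, N ≤ i → a i = 0) :
    ∃ l : YoungDiagram, ∀ i, parts l i = a i := by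
  let l : YoungDiagram :=
    { cells := (Finset.range N ×ˢ Finset.range (a 0)).filter fun c => c.2 < a c.1
      isLowerSet := by
        rintro ⟨i, j⟩ ⟨i', j'⟩ ⟨h1, h2⟩ h
        simp only [Finset.coe_filter, Finset.mem_product, Finset.mem_range,
          Set.mem_ofPred_eq] at h h1 h2 ⊢
        have := ha h1
        omega }
  refine ⟨l, fun i => ?_⟩
  rw [parts_apply]
  have key : ∀ j, j < l.rowLen i ↔ j < a i := by
    intro j
    rw [← YoungDiagram.mem_iff_lt_rowLen, ← YoungDiagram.mem_cells]
    simp only [l, Finset.mem_filter, Finset.mem_product, Finset.mem_range, and_iff_right_iff_imp]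
    intro h
    refine ⟨?_, h.trans_le (ha (Nat.zero_le i))⟩
    by_contra h'
    rw [hN i (not_lt.1 h')] at h
    omega
  exact le_antisymm (not_lt.1 fun h => lt_irrefl _ ((key _).1 h))
    (not_lt.1 fun h => lt_irrefl _ ((key _).2 h))

/-- Sorting an exponent gives a partition. -/
theorem exists_equivMapDomain_eq_parts (d : ℕ →₀ ℕ) :
    ∃ (σ : Perm ℕ) (l : YoungDiagram), d.equivMapDomain σ = parts l := by
  obtain ⟨N, hN⟩ := d.support.exists_nat_subset_range
  have hN' : ∀ i, N ≤ i → d i = 0 := fun i hi => by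
    by_contra h0
    have := Finset.mem_range.1 (hN (Finsupp.mem_support_iff.2 h0))
    omega
  -- the order dual, so that the sorted sequence is decreasing
  let g : Fin N → ℕᵒᵈ := fun i => OrderDual.toDual (d i)
  let r : Perm ℕ := (Tuple.sort g).extendDomain Fin.equivSubtype
  have hr : ∀ i : Fin N, r i = Tuple.sort g i := fun i =>
    Perm.extendDomain_apply_image (Tuple.sort g) Fin.equivSubtype i
  have hr' : ∀ i, N ≤ i → r i = i := fun i hi =>
    Perm.extendDomain_apply_not_subtype _ _ (by omega)
  have hanti : Antitone fun i => d (r i) := by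
    intro i j hij
    rcases lt_or_ge j N with hj | hj
    · have h := Tuple.monotone_sort g (a := ⟨i, hij.trans_lt hj⟩) (b := ⟨j, hj⟩) hij
      have h1 := hr ⟨i, hij.trans_lt hj⟩
      have h2 := hr ⟨j, hj⟩
      simp only at h1 h2 ⊢
      rw [h1, h2]
      exact h
    · simp only [hr' j hj, hN' j hj, Nat.zero_le]
  obtain ⟨l, hl⟩ := exists_parts_eq hanti (N := N) fun i hi => by rw [hr' i hi, hN' i hi]
  refine ⟨r.symm, l, ?_⟩
  ext i
  rw [hl, Finsupp.equivMapDomain_apply]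
  rfl

/-! ### Schur coefficients of symmetric series -/

theorem map_zsmul_eq_mul {F M : Type*} [AddCommGroup M] [FunLike F M ℤ] [AddMonoidHomClass F M ℤ]
    (φ : F) (a : ℤ) (x : M) : φ (a • x) = a * φ x := by
  rw [map_zsmul, smul_eq_mul]

/-- The functional `∑ p, sign p * [x^(l + δ - p δ)] f`. On symmetric `f` it is the coefficient of
`s_l` in the Schur expansion of `f`. -/
noncomputable def schurFunctional (l : YoungDiagram) : MvPowerSeries ℕ ℤ →ₗ[ℤ] ℤ :=
  ∑ p ∈ jacobiPerms (l.colLen 0) l, (Perm.sign p : ℤ) • coeff (jacobiExp l p)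

theorem schurFunctional_apply (l : YoungDiagram) (f : MvPowerSeries ℕ ℤ) :
    schurFunctional l f =
      ∑ p ∈ jacobiPerms (l.colLen 0) l, (Perm.sign p : ℤ) * coeff (jacobiExp l p) f := by
  rw [schurFunctional, LinearMap.sum_apply]
  exact Finset.sum_congr rfl fun p _ => LinearMap.smul_apply _ _ _

theorem continuous_schurFunctional (l : YoungDiagram) : Continuous (schurFunctional l) := by
  have : ⇑(schurFunctional l) = fun f =>
      ∑ p ∈ jacobiPerms (l.colLen 0) l, (Perm.sign p : ℤ) * coeff (jacobiExp l p) f :=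
    funext (schurFunctional_apply l)
  rw [this]
  exact continuous_finsetSum _ fun p _ =>
    continuous_const.mul (MvPowerSeries.WithPiTopology.continuous_coeff ℤ _)

theorem schurFunctional_schur_comm (l m : YoungDiagram) :
    schurFunctional l (schur m) = schurFunctional m (schur l) := by
  rw [schurFunctional_apply, schurFunctional_apply, schur_eq_sum m le_rfl, schur_eq_sum l le_rfl]
  simp only [map_sum, map_zsmul_eq_mul, Finset.mul_sum]
  rw [Finset.sum_comm]
  refine Finset.sum_congr rfl fun q _ => Finset.sum_congr rfl fun p _ => ?_
  rw [coeff_completeProd_comm]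
  ring

/-- The functionals are dual to the Schur functions. When `m` is at most as long as `l`, this is
read off the alternants in as many variables as `l` has parts; otherwise the roles of `l` and `m`
are exchanged, by `schurFunctional_schur_comm`. -/
theorem schurFunctional_schur (l m : YoungDiagram) [Decidable (l = m)] :
    schurFunctional l (schur m) = if l = m then 1 else 0 := by
  have key : ∀ l m : YoungDiagram, m.colLen 0 ≤ l.colLen 0 → ∀ [Decidable (l = m)],
      schurFunctional l (schur m) = if l = m then 1 else 0 := by
    intro l m h _
    rw [schurFunctional_apply, ← coeff_restrict_mul_alternant, isSchurFunction_schur m _ h,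
      coeff_alternant (strictAnti_shift _ m) (strictAnti_shift _ l)]
    refine if_congr ⟨fun h1 => parts_injective (Finsupp.ext fun i => ?_), fun h1 => by rw [h1]⟩
      rfl rfl
    rw [parts_apply, parts_apply]
    rcases lt_or_ge i (l.colLen 0) with hi | hi
    · exact Nat.add_right_cancel (congrFun h1 ⟨i, hi⟩)
    · rw [rowLen_eq_zero hi, rowLen_eq_zero (h.trans hi)]
  rcases le_total (m.colLen 0) (l.colLen 0) with h | h
  · exact key l m h
  · classical
    rw [schurFunctional_schur_comm, key m l h]
    exact if_congr eq_comm rfl rfl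

/-- `s_l` is homogeneous of degree `|l|`. -/
theorem degree_eq_of_coeff_schur_ne_zero {l : YoungDiagram} {d : ℕ →₀ ℕ}
    (h : coeff d (schur l) ≠ 0) : d.degree = weight l := by
  rw [schur_eq_sum l le_rfl, map_sum] at h
  obtain ⟨p, hp, h⟩ := Finset.exists_ne_zero_of_sum_ne_zero h
  rw [map_smul] at h
  rw [degree_eq_of_coeff_completeProd_ne_zero (right_ne_zero_of_smul h), degree_jacobiExp hp]

theorem schurFunctional_eq_zero {l : YoungDiagram} {f : MvPowerSeries ℕ ℤ}
    (h : ∀ d : ℕ →₀ ℕ, d.degree = weight l → coeff d f = 0) : schurFunctional l f = 0 := by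
  rw [schurFunctional_apply]
  exact Finset.sum_eq_zero fun p hp => by rw [h _ (degree_jacobiExp hp), mul_zero]

theorem schurFunctional_mul_schur_eq_zero {v m : YoungDiagram} (h : weight v < weight m)
    (f : MvPowerSeries ℕ ℤ) : schurFunctional v (f * schur m) = 0 := by
  classical
  refine schurFunctional_eq_zero fun d hd => ?_
  rw [coeff_mul]
  refine Finset.sum_eq_zero fun x hx => ?_
  rw [mul_eq_zero]
  right
  by_contra h0
  have h1 := degree_eq_of_coeff_schur_ne_zero h0
  have h2 := congrArg Finsupp.degree (Finset.HasAntidiagonal.mem_antidiagonal.1 hx)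
  rw [map_add] at h2
  omega

theorem schurFunctional_schur_mul_schur_eq_zero {v l m : YoungDiagram}
    (h : weight v ≠ weight l + weight m) : schurFunctional v (schur l * schur m) = 0 := by
  classical
  refine schurFunctional_eq_zero fun d hd => ?_
  rw [coeff_mul]
  refine Finset.sum_eq_zero fun x hx => ?_
  by_contra h0
  have h1 := degree_eq_of_coeff_schur_ne_zero (left_ne_zero_of_mul h0)
  have h3 := degree_eq_of_coeff_schur_ne_zero (right_ne_zero_of_mul h0)
  have h2 := congrArg Finsupp.degree (Finset.HasAntidiagonal.mem_antidiagonal.1 hx)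
  rw [map_add] at h2
  omega

theorem coeff_renameEquiv {ι κ : Type*} (e : ι ≃ κ) (f : MvPowerSeries ι ℤ) (d : ι →₀ ℕ) :
    coeff (d.equivMapDomain e) (renameEquiv ℤ e f) = coeff d f := by
  have h : d.equivMapDomain e = d.embDomain e.toEmbedding := by
    rw [Finsupp.embDomain_eq_mapDomain, Finsupp.equivMapDomain_eq_mapDomain]
    rfl
  rw [h]
  exact coeff_embDomain_rename e.toEmbedding f d

theorem renameEquiv_complete {ι κ : Type*} (e : ι ≃ κ) (k : ℕ) :
    renameEquiv ℤ e (complete Set.univ k) = complete Set.univ k := by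
  classical
  ext d
  obtain ⟨d, rfl⟩ := (Finsupp.equivCongrLeft (M := ℕ) e).surjective d
  rw [Finsupp.equivCongrLeft_apply, coeff_renameEquiv, coeff_complete, coeff_complete,
    Finsupp.equivMapDomain_eq_mapDomain, Finsupp.degree_mapDomain]
  simp

theorem renameEquiv_completeProd {ι κ κ' : Type*} (e : κ ≃ κ') (a : ι →₀ ℕ) :
    renameEquiv ℤ e (completeProd κ a) = completeProd κ' a := by
  rw [completeProd, completeProd, Finsupp.prod, Finsupp.prod, map_prod]
  simp only [renameEquiv_complete]

/-- The algebra of symmetric power series: those fixed by every permutation of the variables. -/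
noncomputable def symmetricSeries : Subalgebra ℤ (MvPowerSeries ℕ ℤ) :=
  ⨅ σ : Perm ℕ, AlgHom.equalizer (renameEquiv ℤ σ : MvPowerSeries ℕ ℤ →ₐ[ℤ] _) (AlgHom.id ℤ _)

theorem mem_symmetricSeries {f : MvPowerSeries ℕ ℤ} :
    f ∈ symmetricSeries ↔ ∀ σ : Perm ℕ, renameEquiv ℤ σ f = f := by
  simp [symmetricSeries, Algebra.mem_iInf, AlgHom.mem_equalizer]

theorem mem_symmetricSeries_iff_coeff {f : MvPowerSeries ℕ ℤ} :
    f ∈ symmetricSeries ↔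
      ∀ (σ : Perm ℕ) (d : ℕ →₀ ℕ), coeff (d.equivMapDomain σ) f = coeff d f := by
  rw [mem_symmetricSeries]
  constructor
  · intro h σ d
    rw [← coeff_renameEquiv σ f d, h]
  · intro h σ
    ext d
    obtain ⟨d, rfl⟩ := (Finsupp.equivCongrLeft (M := ℕ) σ).surjective d
    rw [Finsupp.equivCongrLeft_apply, coeff_renameEquiv, h]

theorem isClosed_symmetricSeries : IsClosed (symmetricSeries : Set (MvPowerSeries ℕ ℤ)) := by
  have : (symmetricSeries : Set (MvPowerSeries ℕ ℤ)) =
      ⋂ (σ : Perm ℕ) (d : ℕ →₀ ℕ), {f | coeff (d.equivMapDomain σ) f = coeff d f} := by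
    ext f
    simp only [SetLike.mem_coe, mem_symmetricSeries_iff_coeff, Set.mem_iInter]
    rfl
  rw [this]
  exact isClosed_iInter fun σ => isClosed_iInter fun d =>
    isClosed_eq (MvPowerSeries.WithPiTopology.continuous_coeff ℤ _)
      (MvPowerSeries.WithPiTopology.continuous_coeff ℤ _)

/-- A closed submodule contains the sums of its families. -/
theorem mem_of_hasSum {R M ι : Type*} [CommRing R] [AddCommGroup M] [Module R M]
    [TopologicalSpace M] {p : Submodule R M} (hp : IsClosed (p : Set M)) {g : ι → M} {x : M}
    (hg : ∀ i, g i ∈ p) (h : HasSum g x) : x ∈ p :=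
  hp.mem_of_tendsto h (Filter.Eventually.of_forall fun _ => p.sum_mem fun i _ => hg i)

theorem completeProd_mem_symmetricSeries {ι : Type*} (a : ι →₀ ℕ) :
    completeProd ℕ a ∈ symmetricSeries :=
  mem_symmetricSeries.2 fun σ => renameEquiv_completeProd σ a

theorem schur_mem_symmetricSeries (l : YoungDiagram) : schur l ∈ symmetricSeries := by
  rw [schur_eq_sum l le_rfl]
  exact sum_mem fun p _ => Subalgebra.smul_mem _ (completeProd_mem_symmetricSeries _) _

theorem IsSchurSeries.mem_symmetricSeries {X : MvPowerSeries ℕ ℤ} (h : IsSchurSeries X) :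
    X ∈ symmetricSeries := by
  obtain ⟨a, ha⟩ := h
  exact mem_of_hasSum (p := Subalgebra.toSubmodule symmetricSeries) isClosed_symmetricSeries
    (fun l => Subalgebra.smul_mem _ (schur_mem_symmetricSeries l) _) ha

/-- A symmetric series all of whose Schur coefficients are zero is zero. The coefficient of `x^d` is
shown to vanish by downward induction on the sum of the squares of the entries of `d`, which is
bounded in each degree. -/
theorem eq_zero_of_schurFunctional_eq_zero {f : MvPowerSeries ℕ ℤ} (hf : f ∈ symmetricSeries)
    (h : ∀ l, schurFunctional l f = 0) : f = 0 := by
  classical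
  rw [mem_symmetricSeries_iff_coeff] at hf
  -- the truncated subtraction is exact, by `sumSq_le`
  have key : ∀ k, ∀ d : ℕ →₀ ℕ, d.degree ^ 2 - sumSq d = k → coeff d f = 0 := by
    intro k
    induction k using Nat.strong_induction_on with
    | _ k ih =>
      intro d hk
      obtain ⟨σ, l, hl⟩ := exists_equivMapDomain_eq_parts d
      have hdeg : d.degree = weight l := by
        rw [weight, ← hl, Finsupp.equivMapDomain_eq_mapDomain, Finsupp.degree_mapDomain]
      have hsq : sumSq d = sumSq (parts l) := by
        rw [← hl, sumSq, sumSq, Finsupp.sum_equivMapDomain]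
      have h1 : (1 : Perm (Fin (l.colLen 0))) ∈ jacobiPerms (l.colLen 0) l := by
        simp [jacobiPerms]
      have h2 := h l
      rw [schurFunctional_apply, Finset.sum_eq_single_of_mem 1 h1] at h2
      · have h3 : jacobiExp l (1 : Perm (Fin (l.colLen 0))) = parts l := by
          simp [jacobiExp, parts]
        rw [← hf σ d, hl, ← h3]
        simpa using h2
      -- for `p ≠ 1` the coefficient vanishes by induction, as the sum of squares increases
      · intro p hp hp1
        have h4 := sumSq_lt_sumSq_jacobiExp hp hp1
        have h5 := sumSq_le (jacobiExp l p)
        have h6 := degree_jacobiExp hp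
        rw [ih _ _ (jacobiExp l p) rfl, mul_zero]
        rw [h6] at h5 ⊢
        rw [hdeg] at hk
        omega
  ext d
  exact key _ d rfl

theorem ext_schurFunctional {f g : MvPowerSeries ℕ ℤ} (hf : f ∈ symmetricSeries)
    (hg : g ∈ symmetricSeries) (h : ∀ l, schurFunctional l f = schurFunctional l g) : f = g :=
  sub_eq_zero.1 (eq_zero_of_schurFunctional_eq_zero (sub_mem hf hg) fun l => by
    rw [map_sub, h, sub_self])

theorem summable_smul_schur (a : YoungDiagram → ℤ) : Summable fun l => a l • schur l := by
  rw [MvPowerSeries.WithPiTopology.summable_iff_summable_coeff]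
  intro d
  refine summable_of_hasFiniteSupport ((finite_weight_le d.degree).subset fun l hl => ?_)
  rw [Function.mem_support, map_smul] at hl
  exact (degree_eq_of_coeff_schur_ne_zero (right_ne_zero_of_smul hl)).ge

theorem schurFunctional_of_hasSum {a : YoungDiagram → ℤ} {X : MvPowerSeries ℕ ℤ}
    (h : HasSum (fun l => a l • schur l) X) (l : YoungDiagram) : schurFunctional l X = a l := by
  classical
  have h1 := h.map (schurFunctional l) (continuous_schurFunctional l)
  refine h1.unique ?_
  convert hasSum_ite_eq l (a l) using 2 with m
  simp only [Function.comp, map_smul, schurFunctional_schur, smul_eq_mul, mul_ite, mul_one,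
    mul_zero, eq_comm (a := l)]
  split_ifs with h
  · rw [h]
  · rfl

/-- Every symmetric series is a series of Schur functions. -/
theorem hasSum_schurFunctional {f : MvPowerSeries ℕ ℤ} (hf : f ∈ symmetricSeries) :
    HasSum (fun l => schurFunctional l f • schur l) f := by
  obtain ⟨g, hg⟩ := summable_smul_schur fun l => schurFunctional l f
  have hg' : IsSchurSeries g := ⟨_, hg⟩
  have : f = g := ext_schurFunctional hf hg'.mem_symmetricSeries fun l =>
    (schurFunctional_of_hasSum hg l).symm
  rwa [← this] at hg

theorem schurCoeff_eq {f : MvPowerSeries ℕ ℤ} (hf : f ∈ symmetricSeries) (l : YoungDiagram) :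
    schurCoeff f l = schurFunctional l f := by
  have h : IsSchurSeries f := ⟨_, hasSum_schurFunctional hf⟩
  rw [schurCoeff, dif_pos h]
  exact (schurFunctional_of_hasSum h.choose_spec l).symm

/-! ### Two alphabets and the coproduct -/

theorem coeff_tensor (f g : MvPowerSeries ℕ ℤ) (a b : ℕ →₀ ℕ) :
    coeff (a.sumElim b) (tensor f g) = coeff a f * coeff b g := by
  classical
  have hl : a.sumElim (0 : ℕ →₀ ℕ) = a.embDomain Function.Embedding.inl := by
    ext (i | i)
    · exact (Finsupp.embDomain_apply_self Function.Embedding.inl a i).symm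
    · exact (Finsupp.embDomain_of_notMem_range Function.Embedding.inl a _ (by simp)).symm
  have hr : (0 : ℕ →₀ ℕ).sumElim b = b.embDomain Function.Embedding.inr := by
    ext (i | i)
    · exact (Finsupp.embDomain_of_notMem_range Function.Embedding.inr b _ (by simp)).symm
    · exact (Finsupp.embDomain_apply_self Function.Embedding.inr b i).symm
  rw [tensor, coeff_mul, Finset.sum_eq_single (a.sumElim 0, Finsupp.sumElim 0 b)]
  · simp only [hl, hr]
    rw [coeff_embDomain_rename, coeff_embDomain_rename]
  · rintro ⟨c, d⟩ hcd hne
    rw [Finset.HasAntidiagonal.mem_antidiagonal] at hcd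
    by_contra h0
    have h1 := not_imp_comm.1 (coeff_rename_eq_zero _ f (x := c)) (left_ne_zero_of_mul h0)
    have h2 := not_imp_comm.1 (coeff_rename_eq_zero _ g (x := d)) (right_ne_zero_of_mul h0)
    obtain ⟨c', rfl⟩ := h1
    obtain ⟨d', rfl⟩ := h2
    have hc : ∀ i, Finsupp.mapDomain (Function.Embedding.inl : ℕ ↪ ℕ ⊕ ℕ) c' (Sum.inr i) = 0 :=
      fun i => Finsupp.mapDomain_of_notMem_range _ _ (by simp)
    have hd : ∀ i, Finsupp.mapDomain (Function.Embedding.inr : ℕ ↪ ℕ ⊕ ℕ) d' (Sum.inl i) = 0 :=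
      fun i => Finsupp.mapDomain_of_notMem_range _ _ (by simp)
    apply hne
    simp only at hcd
    rw [Prod.mk.injEq]
    constructor
    · ext (i | i)
      · have := DFunLike.congr_fun hcd (Sum.inl i)
        rw [Finsupp.add_apply, hd, add_zero] at this
        exact this
      · exact hc i
    · ext (i | i)
      · exact hd i
      · have := DFunLike.congr_fun hcd (Sum.inr i)
        rw [Finsupp.add_apply, hc, zero_add] at this
        exact this
  · intro h
    refine absurd (Finset.HasAntidiagonal.mem_antidiagonal.2 ?_) h
    ext (i | i) <;> simp

theorem exists_eq_sumElim (d : ℕ ⊕ ℕ →₀ ℕ) : ∃ a b : ℕ →₀ ℕ, d = a.sumElim b := by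
  obtain ⟨⟨a, b⟩, h⟩ := Finsupp.sumFinsuppEquivProdFinsupp.symm.surjective d
  exact ⟨a, b, h.symm⟩

theorem sumElim_eq_add (a b : ℕ →₀ ℕ) :
    a.sumElim b = a.mapDomain Sum.inl + b.mapDomain Sum.inr := by
  ext (i | i)
  · rw [Finsupp.add_apply, Finsupp.mapDomain_apply Sum.inl_injective,
      Finsupp.mapDomain_of_notMem_range _ _ (by simp), add_zero, Finsupp.sumElim_inl]
  · rw [Finsupp.add_apply, Finsupp.mapDomain_apply Sum.inr_injective,
      Finsupp.mapDomain_of_notMem_range _ _ (by simp), zero_add, Finsupp.sumElim_inr]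

theorem degree_sumElim (a b : ℕ →₀ ℕ) : (a.sumElim b).degree = a.degree + b.degree := by
  rw [sumElim_eq_add, map_add, Finsupp.degree_mapDomain, Finsupp.degree_mapDomain]

theorem completeProd_sumElim (κ : Type*) (a b : ℕ →₀ ℕ) :
    completeProd κ (a.sumElim b) = completeProd κ a * completeProd κ b := by
  classical
  rw [sumElim_eq_add, completeProd, Finsupp.prod_add_index_of_disjoint, completeProd, completeProd,
    Finsupp.prod_mapDomain_index_inj Sum.inl_injective,
    Finsupp.prod_mapDomain_index_inj Sum.inr_injective]
  rw [Finset.disjoint_left]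
  intro x hx hx'
  obtain ⟨i, _, rfl⟩ := Finset.mem_image.1 (Finsupp.mapDomain_support hx)
  obtain ⟨j, _, hj⟩ := Finset.mem_image.1 (Finsupp.mapDomain_support hx')
  cases hj

/-- The functional `schurFunctional l ⊗ schurFunctional m` on series in two alphabets. -/
noncomputable def tensorFunctional (l m : YoungDiagram) : MvPowerSeries (ℕ ⊕ ℕ) ℤ →ₗ[ℤ] ℤ :=
  ∑ p ∈ jacobiPerms (l.colLen 0) l, ∑ q ∈ jacobiPerms (m.colLen 0) m,
    ((Perm.sign p : ℤ) * (Perm.sign q : ℤ)) • coeff ((jacobiExp l p).sumElim (jacobiExp m q))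

theorem tensorFunctional_apply (l m : YoungDiagram) (Z : MvPowerSeries (ℕ ⊕ ℕ) ℤ) :
    tensorFunctional l m Z =
      ∑ p ∈ jacobiPerms (l.colLen 0) l, ∑ q ∈ jacobiPerms (m.colLen 0) m,
        ((Perm.sign p : ℤ) * (Perm.sign q : ℤ)) *
          coeff ((jacobiExp l p).sumElim (jacobiExp m q)) Z := by
  rw [tensorFunctional, LinearMap.sum_apply]
  refine Finset.sum_congr rfl fun p _ => ?_
  rw [LinearMap.sum_apply]
  exact Finset.sum_congr rfl fun q _ => LinearMap.smul_apply _ _ _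

theorem continuous_tensorFunctional (l m : YoungDiagram) :
    Continuous (tensorFunctional l m) := by
  rw [funext (tensorFunctional_apply l m)]
  exact continuous_finsetSum _ fun p _ => continuous_finsetSum _ fun q _ =>
    continuous_const.mul (MvPowerSeries.WithPiTopology.continuous_coeff ℤ _)

theorem tensorFunctional_tensor (l m : YoungDiagram) (f g : MvPowerSeries ℕ ℤ) :
    tensorFunctional l m (tensor f g) = schurFunctional l f * schurFunctional m g := by
  rw [tensorFunctional_apply, schurFunctional_apply, schurFunctional_apply, Finset.sum_mul_sum]
  refine Finset.sum_congr rfl fun p _ => Finset.sum_congr rfl fun q _ => ?_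
  rw [coeff_tensor]
  ring

theorem coproduct_schur (v : YoungDiagram) : coproduct (schur v) =
    ∑ r ∈ jacobiPerms (v.colLen 0) v,
      (Perm.sign r : ℤ) • completeProd (ℕ ⊕ ℕ) (jacobiExp v r) := by
  rw [schur_eq_sum v le_rfl, coproduct, map_sum]
  refine Finset.sum_congr rfl fun r _ => ?_
  rw [map_zsmul, renameEquiv_completeProd]

/-- Self-duality: the coefficient of `s_v` in `s_l s_m` is the coefficient of `s_l ⊗ s_m` in
`Δ(s_v)`. Both sides are signed sums of coefficients of products `h_a`, matched by
`coeff_completeProd_comm`. -/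
theorem schurFunctional_schur_mul_schur (v l m : YoungDiagram) :
    schurFunctional v (schur l * schur m) = tensorFunctional l m (coproduct (schur v)) := by
  rw [coproduct_schur, schur_eq_sum l le_rfl, schur_eq_sum m le_rfl, Finset.sum_mul_sum,
    schurFunctional_apply, map_sum]
  refine Finset.sum_congr rfl fun r _ => ?_
  rw [map_zsmul_eq_mul, tensorFunctional_apply, map_sum]
  congr 1
  refine Finset.sum_congr rfl fun p _ => ?_
  rw [map_sum]
  refine Finset.sum_congr rfl fun q _ => ?_
  rw [smul_mul_smul_comm, map_zsmul_eq_mul, ← completeProd_sumElim, coeff_completeProd_comm]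

theorem continuous_renameEquiv {ι κ : Type*} (e : ι ≃ κ) :
    Continuous (renameEquiv ℤ e : MvPowerSeries ι ℤ → MvPowerSeries κ ℤ) := by
  refine continuous_pi fun d => ?_
  obtain ⟨d, rfl⟩ := (Finsupp.equivCongrLeft (M := ℕ) e).surjective d
  exact (MvPowerSeries.WithPiTopology.continuous_coeff ℤ d).congr fun f =>
    (coeff_renameEquiv e f d).symm

theorem continuous_coproduct : Continuous coproduct := continuous_renameEquiv _

theorem tensor_mul_tensor (f g f' g' : MvPowerSeries ℕ ℤ) :
    tensor f g * tensor f' g' = tensor (f * f') (g * g') := by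
  rw [tensor, tensor, tensor, map_mul, map_mul]
  ring

theorem tensor_one_one : tensor 1 1 = 1 := by
  rw [tensor, map_one, map_one, mul_one]

theorem coproduct_complete (k : ℕ) : coproduct (complete Set.univ k) =
    ∑ x ∈ Finset.HasAntidiagonal.antidiagonal k,
      tensor (complete Set.univ x.1) (complete Set.univ x.2) := by
  classical
  rw [coproduct, renameEquiv_complete]
  ext d
  obtain ⟨a, b, rfl⟩ := exists_eq_sumElim d
  rw [map_sum]
  simp only [coeff_tensor, coeff_complete, degree_sumElim, Set.subset_univ, and_true,
    ← ite_and, mul_ite, mul_one, mul_zero]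
  by_cases h : a.degree + b.degree = k
  · rw [if_pos h, Finset.sum_eq_single (a.degree, b.degree)]
    · simp
    · rintro ⟨i, j⟩ _ hne
      rw [if_neg]
      rintro ⟨rfl, rfl⟩
      exact hne rfl
    · intro h'
      exact absurd (Finset.HasAntidiagonal.mem_antidiagonal.2 h) h'
  · rw [if_neg h]
    symm
    refine Finset.sum_eq_zero fun x hx => ?_
    rw [if_neg]
    rintro ⟨h1, h2⟩
    rw [Finset.HasAntidiagonal.mem_antidiagonal] at hx
    omega

/-- The pure tensors `f ⊗ g` of symmetric power series. -/
noncomputable def symmetricTensors : Submonoid (MvPowerSeries (ℕ ⊕ ℕ) ℤ) where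
  carrier := {Z | ∃ f ∈ symmetricSeries, ∃ g ∈ symmetricSeries, tensor f g = Z}
  one_mem' := ⟨1, one_mem _, 1, one_mem _, tensor_one_one⟩
  mul_mem' := by
    rintro _ _ ⟨f, hf, g, hg, rfl⟩ ⟨f', hf', g', hg', rfl⟩
    exact ⟨_, mul_mem hf hf', _, mul_mem hg hg', (tensor_mul_tensor f g f' g').symm⟩

/-- The closed algebra generated by the tensors `f ⊗ g` of symmetric power series. -/
noncomputable def bisymmetricSeries : Subalgebra ℤ (MvPowerSeries (ℕ ⊕ ℕ) ℤ) :=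
  (Algebra.adjoin ℤ (symmetricTensors : Set (MvPowerSeries (ℕ ⊕ ℕ) ℤ))).topologicalClosure

theorem isClosed_bisymmetricSeries :
    IsClosed (bisymmetricSeries : Set (MvPowerSeries (ℕ ⊕ ℕ) ℤ)) :=
  Subalgebra.isClosed_topologicalClosure _

theorem tensor_mem_bisymmetricSeries {f g : MvPowerSeries ℕ ℤ} (hf : f ∈ symmetricSeries)
    (hg : g ∈ symmetricSeries) : tensor f g ∈ bisymmetricSeries :=
  Subalgebra.le_topologicalClosure _ (Algebra.subset_adjoin ⟨f, hf, g, hg, rfl⟩)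

theorem complete_mem_symmetricSeries (k : ℕ) : complete Set.univ k ∈ symmetricSeries :=
  mem_symmetricSeries.2 fun σ => renameEquiv_complete σ k

/-- It suffices to consider `h_k`, as `coproduct` is a continuous ring homomorphism. -/
theorem coproduct_mem_bisymmetricSeries {Y : MvPowerSeries ℕ ℤ} (hY : Y ∈ symmetricSeries) :
    coproduct Y ∈ bisymmetricSeries := by
  have h1 : ∀ k, coproduct (complete Set.univ k) ∈ bisymmetricSeries := fun k => by
    rw [coproduct_complete]
    exact sum_mem fun x _ => tensor_mem_bisymmetricSeries (complete_mem_symmetricSeries _)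
      (complete_mem_symmetricSeries _)
  have h2 : ∀ l, coproduct (schur l) ∈ bisymmetricSeries := fun l => by
    rw [schur_eq_sum l le_rfl, coproduct, map_sum]
    refine sum_mem fun p _ => ?_
    rw [map_zsmul]
    refine zsmul_mem ?_ _
    rw [completeProd, Finsupp.prod, map_prod]
    exact prod_mem fun i _ => h1 _
  have h3 := (hasSum_schurFunctional hY).map
    (renameEquiv ℤ Equiv.natSumNatEquivNat.symm : MvPowerSeries ℕ ℤ ≃ₐ[ℤ] _)
    (continuous_renameEquiv _)
  refine mem_of_hasSum (p := Subalgebra.toSubmodule bisymmetricSeries) isClosed_bisymmetricSeries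
    (fun l => ?_) h3
  rw [Function.comp, map_zsmul]
  exact zsmul_mem (h2 l) _

/-! ### Skewing as an adjoint -/

/-- The element `∑ l, h l • s_l` with finitely many given Schur coefficients. -/
noncomputable def schurComb : (YoungDiagram →₀ ℤ) →+ MvPowerSeries ℕ ℤ where
  toFun h := h.sum fun l a => a • schur l
  map_zero' := Finsupp.sum_zero_index
  map_add' _ _ := Finsupp.sum_add_index' (fun _ => zero_smul _ _) fun _ _ _ => add_smul _ _ _

theorem schurComb_apply (h : YoungDiagram →₀ ℤ) :
    schurComb h = h.sum fun l a => a • schur l := rfl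

/-- The pairing of a series `Y` with a finite combination of Schur functions, for which the
Schur functions are orthonormal. -/
noncomputable def pairing (Y : MvPowerSeries ℕ ℤ) : (YoungDiagram →₀ ℤ) →ₗ[ℤ] ℤ :=
  Finsupp.linearCombination ℤ fun l => schurFunctional l Y

theorem pairing_single (Y : MvPowerSeries ℕ ℤ) (l : YoungDiagram) :
    pairing Y (Finsupp.single l 1) = schurFunctional l Y := by
  rw [pairing, Finsupp.linearCombination_single, one_smul]

theorem pairing_schur (m : YoungDiagram) (h : YoungDiagram →₀ ℤ) : pairing (schur m) h = h m := by
  classical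
  rw [pairing, Finsupp.linearCombination_apply]
  simp only [schurFunctional_schur, smul_eq_mul, mul_ite, mul_one, mul_zero]
  rw [Finsupp.sum_ite_eq']
  simpa using fun h0 : h m = 0 => h0.symm

theorem ext_pairing {h k : YoungDiagram →₀ ℤ}
    (H : ∀ Y ∈ symmetricSeries, pairing Y h = pairing Y k) : h = k := by
  ext m
  rw [← pairing_schur, ← pairing_schur, H _ (schur_mem_symmetricSeries m)]

/-- Additive maps on finite combinations of Schur functions agree if they agree on the basis. -/
theorem addHom_ext_single {M : Type*} [AddCommGroup M] {φ ψ : (YoungDiagram →₀ ℤ) →+ M}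
    (H : ∀ l, φ (Finsupp.single l 1) = ψ (Finsupp.single l 1)) : φ = ψ := by
  refine Finsupp.addHom_ext fun l a => ?_
  have : Finsupp.single l a = a • Finsupp.single l (1 : ℤ) := by
    rw [Finsupp.smul_single, smul_eq_mul, mul_one]
  rw [this, map_zsmul, map_zsmul, H]

theorem schurComb_single (l : YoungDiagram) (a : ℤ) :
    schurComb (Finsupp.single l a) = a • schur l :=
  Finsupp.sum_single_index (h := fun l a => a • schur l) (zero_zsmul _)

theorem schurComb_mem_symmetricSeries (h : YoungDiagram →₀ ℤ) :
    schurComb h ∈ symmetricSeries :=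
  sum_mem fun l _ => zsmul_mem (schur_mem_symmetricSeries l) _

theorem schurFunctional_schurComb (m : YoungDiagram) (h : YoungDiagram →₀ ℤ) :
    schurFunctional m (schurComb h) = h m := by
  classical
  rw [schurComb_apply, Finsupp.sum, map_sum]
  simp only [map_zsmul_eq_mul, schurFunctional_schur, mul_ite, mul_one, mul_zero]
  rw [Finset.sum_ite_eq]
  simpa using fun h0 : h m = 0 => h0.symm

theorem schurComb_eq_finsum (h : YoungDiagram →₀ ℤ) :
    schurComb h = ∑ᶠ l, h l • schur l := by
  rw [schurComb_apply, Finsupp.sum]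
  symm
  refine finsum_eq_sum_of_support_subset _ fun l hl => ?_
  rw [Finset.mem_coe, Finsupp.mem_support_iff]
  intro h0
  rw [Function.mem_support, h0, zero_smul] at hl
  exact hl rfl

/-- The value of `skew X` on the basis element of `v`. -/
noncomputable def skewSingle (X : MvPowerSeries ℕ ℤ) (v : YoungDiagram) : YoungDiagram →₀ ℤ :=
  Finsupp.onFinset (finite_weight_le (weight v)).toFinset
    (fun m => schurFunctional v (X * schur m)) fun m hm => by
      rw [Set.Finite.mem_toFinset]
      by_contra h
      exact hm (schurFunctional_mul_schur_eq_zero (not_le.1 h) X)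

/-- Skewing by `X`: the adjoint, for `pairing`, of multiplication by `X`. -/
noncomputable def skew (X : MvPowerSeries ℕ ℤ) : (YoungDiagram →₀ ℤ) →ₗ[ℤ] (YoungDiagram →₀ ℤ) :=
  Finsupp.linearCombination ℤ (skewSingle X)

theorem skew_single_apply (X : MvPowerSeries ℕ ℤ) (v m : YoungDiagram) :
    skew X (Finsupp.single v 1) m = schurFunctional v (X * schur m) := by
  rw [skew, Finsupp.linearCombination_single, one_smul]
  rfl

/-- A continuous functional `φ` on a convergent sum, when all but finitely many of the terms lie
in the kernel of `φ`. -/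
theorem map_eq_sum_of_hasSum {ι F M : Type*} [AddCommGroup M] [TopologicalSpace M] [FunLike F M ℤ]
    [AddMonoidHomClass F M ℤ] {φ : F} (hφ : Continuous φ) {a : ι → ℤ} {s : ι → M} {D : M}
    (hD : HasSum (fun i => a i • s i) D) (A : Finset ι) (hA : ∀ i ∉ A, φ (s i) = 0) :
    φ D = ∑ i ∈ A, a i * φ (s i) := by
  have h1 := hD.map φ hφ
  have h2 : (⇑φ ∘ fun i => a i • s i) = fun i => a i * φ (s i) :=
    funext fun i => map_zsmul_eq_mul φ _ _
  rw [h2] at h1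
  refine h1.unique (hasSum_sum_of_ne_finset_zero fun i hi => ?_)
  rw [hA i hi, mul_zero]

theorem pairing_skew {Y : MvPowerSeries ℕ ℤ} (hY : Y ∈ symmetricSeries) (X : MvPowerSeries ℕ ℤ)
    (h : YoungDiagram →₀ ℤ) : pairing Y (skew X h) = pairing (X * Y) h := by
  have key : ((pairing Y).comp (skew X)).toAddMonoidHom = (pairing (X * Y)).toAddMonoidHom := by
    refine addHom_ext_single fun v => ?_
    change pairing Y (skew X (Finsupp.single v 1)) = pairing (X * Y) (Finsupp.single v 1)
    rw [pairing_single]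
    have h1 := map_eq_sum_of_hasSum
      (φ := (schurFunctional v).toAddMonoidHom.comp (AddMonoidHom.mulLeft X))
      ((continuous_schurFunctional v).comp (continuous_const.mul continuous_id))
      (hasSum_schurFunctional hY) (finite_weight_le (weight v)).toFinset fun m hm => by
        rw [Set.Finite.mem_toFinset] at hm
        exact schurFunctional_mul_schur_eq_zero (not_le.1 hm) X
    refine Eq.trans ?_ h1.symm
    rw [skew, Finsupp.linearCombination_single, one_smul, pairing, Finsupp.linearCombination_apply,
      skewSingle, Finsupp.onFinset_sum (g := fun i a => a • schurFunctional i Y) _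
        fun _ => zero_smul _ _]
    exact Finset.sum_congr rfl fun m _ => mul_comm _ _
  exact DFunLike.congr_fun key h

theorem skew_skew (X : MvPowerSeries ℕ ℤ) {Y : MvPowerSeries ℕ ℤ} (hY : Y ∈ symmetricSeries)
    (h : YoungDiagram →₀ ℤ) : skew Y (skew X h) = skew (X * Y) h :=
  ext_pairing fun Z hZ => by
    rw [pairing_skew hZ, pairing_skew (mul_mem hY hZ), pairing_skew hZ, mul_assoc]

theorem skew_one (h : YoungDiagram →₀ ℤ) : skew 1 h = h :=
  ext_pairing fun Y hY => by rw [pairing_skew hY, one_mul]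

/-- `s_{v/s} = 0` when `|v| < |s|`. -/
theorem skew_schur_single_eq_zero {s v : YoungDiagram} (h : weight v < weight s) :
    skew (schur s) (Finsupp.single v 1) = 0 := by
  ext m
  rw [skew_single_apply, mul_comm, schurFunctional_mul_schur_eq_zero h]
  rfl

/-- The Schur coefficients of `s_l s_m`. -/
noncomputable def schurMul (l m : YoungDiagram) : YoungDiagram →₀ ℤ :=
  Finsupp.onFinset (finite_weight_le (weight l + weight m)).toFinset
    (fun v => schurFunctional v (schur l * schur m)) fun v hv => by
      rw [Set.Finite.mem_toFinset]
      by_contra h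
      exact hv (schurFunctional_schur_mul_schur_eq_zero fun h' => h h'.le)

/-- The product of finite combinations of Schur functions. -/
noncomputable def combMul : (YoungDiagram →₀ ℤ) →ₗ[ℤ] (YoungDiagram →₀ ℤ) →ₗ[ℤ]
    (YoungDiagram →₀ ℤ) :=
  Finsupp.linearCombination ℤ fun l => Finsupp.linearCombination ℤ fun m => schurMul l m

theorem schurComb_schurMul (l m : YoungDiagram) :
    schurComb (schurMul l m) = schur l * schur m :=
  ext_schurFunctional (schurComb_mem_symmetricSeries _)
    (mul_mem (schur_mem_symmetricSeries l) (schur_mem_symmetricSeries m)) fun v => by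
      rw [schurFunctional_schurComb]
      rfl

theorem schurComb_combMul (f g : YoungDiagram →₀ ℤ) :
    schurComb (combMul f g) = schurComb f * schurComb g := by
  induction f using Finsupp.induction_linear with
  | zero => simp
  | add f₁ f₂ h₁ h₂ => rw [map_add, LinearMap.add_apply, map_add, h₁, h₂, map_add, add_mul]
  | single l a =>
    induction g using Finsupp.induction_linear with
    | zero => simp
    | add g₁ g₂ h₁ h₂ => rw [map_add, map_add, h₁, h₂, map_add, mul_add]
    | single m c =>
      rw [combMul, Finsupp.linearCombination_single, LinearMap.smul_apply,
        Finsupp.linearCombination_single, map_zsmul, map_zsmul, schurComb_schurMul,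
        schurComb_single, schurComb_single, smul_mul_smul_comm, smul_smul]

/-- The pairing of a series in two alphabets with the tensor of two finite combinations of Schur
functions. -/
noncomputable def tensorPairing (Z : MvPowerSeries (ℕ ⊕ ℕ) ℤ) (f g : YoungDiagram →₀ ℤ) : ℤ :=
  f.sum fun l a => g.sum fun m c => a * (c * tensorFunctional l m Z)

theorem continuous_tensorPairing (f g : YoungDiagram →₀ ℤ) :
    Continuous fun Z => tensorPairing Z f g :=
  continuous_finsetSum _ fun l _ => continuous_finsetSum _ fun m _ =>
    continuous_const.mul (continuous_const.mul (continuous_tensorFunctional l m))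

/-- `tensorPairing` as an additive map of its first argument. -/
noncomputable def tensorPairingHom (f g : YoungDiagram →₀ ℤ) :
    MvPowerSeries (ℕ ⊕ ℕ) ℤ →+ ℤ where
  toFun Z := tensorPairing Z f g
  map_zero' := by simp [tensorPairing]
  map_add' Z Z' := by simp [tensorPairing, mul_add, Finsupp.sum, Finset.sum_add_distrib]

theorem tensorPairing_tensor (p q : MvPowerSeries ℕ ℤ) (f g : YoungDiagram →₀ ℤ) :
    tensorPairing (tensor p q) f g = pairing p f * pairing q g := by
  simp only [tensorPairing, tensorFunctional_tensor, pairing, Finsupp.linearCombination_apply,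
    Finsupp.sum, Finset.sum_mul_sum, smul_eq_mul]
  refine Finset.sum_congr rfl fun l _ => Finset.sum_congr rfl fun m _ => ?_
  ring

/-- `⟨Y, f g⟩ = ⟨Δ(Y), f ⊗ g⟩`. -/
theorem pairing_combMul {Y : MvPowerSeries ℕ ℤ} (hY : Y ∈ symmetricSeries)
    (f g : YoungDiagram →₀ ℤ) :
    pairing Y (combMul f g) = tensorPairing (coproduct Y) f g := by
  have key : ∀ l m, pairing Y (schurMul l m) = tensorFunctional l m (coproduct Y) := by
    intro l m
    have h1 := map_eq_sum_of_hasSum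
      (φ := (tensorFunctional l m).toAddMonoidHom.comp
        (renameEquiv ℤ Equiv.natSumNatEquivNat.symm :
          MvPowerSeries ℕ ℤ ≃ₐ[ℤ] MvPowerSeries (ℕ ⊕ ℕ) ℤ).toAlgHom.toRingHom.toAddMonoidHom)
      ((continuous_tensorFunctional l m).comp continuous_coproduct)
      (hasSum_schurFunctional hY) (finite_weight_le (weight l + weight m)).toFinset fun v hv => by
        rw [Set.Finite.mem_toFinset] at hv
        exact (schurFunctional_schur_mul_schur v l m).symm.trans
          (schurFunctional_schur_mul_schur_eq_zero fun h' => hv h'.le)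
    refine Eq.trans ?_ h1.symm
    rw [pairing, Finsupp.linearCombination_apply, schurMul,
      Finsupp.onFinset_sum (g := fun i a => a • schurFunctional i Y) _ fun _ => zero_smul _ _]
    refine Finset.sum_congr rfl fun v _ => ?_
    rw [schurFunctional_schur_mul_schur, smul_eq_mul, mul_comm]
    rfl
  rw [combMul, Finsupp.linearCombination_apply, Finsupp.sum, LinearMap.sum_apply, map_sum]
  refine Finset.sum_congr rfl fun l _ => ?_
  rw [LinearMap.smul_apply, map_smul, Finsupp.linearCombination_apply, map_finsuppSum, smul_eq_mul,
    Finsupp.sum, Finset.mul_sum]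
  refine Finset.sum_congr rfl fun m _ => ?_
  rw [map_smul, key, smul_eq_mul]

/-- Skewing both factors is adjoint to multiplication by a tensor. -/
theorem tensorPairing_tensor_mul {Z : MvPowerSeries (ℕ ⊕ ℕ) ℤ} (hZ : Z ∈ bisymmetricSeries)
    (p q : MvPowerSeries ℕ ℤ) (f g : YoungDiagram →₀ ℤ) :
    tensorPairing (tensor p q * Z) f g = tensorPairing Z (skew p f) (skew q g) := by
  have hclosed : IsClosed {Z | tensorPairing (tensor p q * Z) f g =
      tensorPairing Z (skew p f) (skew q g)} :=
    isClosed_eq ((continuous_tensorPairing f g).comp (continuous_const.mul continuous_id))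
      (continuous_tensorPairing _ _)
  -- both sides are continuous in `Z`, and additive, so `Z` may be taken to be a pure tensor
  refine closure_minimal (fun Z hZ => ?_) hclosed hZ
  have hZ' : Z ∈ Subalgebra.toSubmodule
      (Algebra.adjoin ℤ (symmetricTensors : Set (MvPowerSeries (ℕ ⊕ ℕ) ℤ))) := hZ
  rw [Algebra.adjoin_eq_span, Submonoid.closure_eq] at hZ'
  have hadd : ∀ (f g : YoungDiagram →₀ ℤ) (Z Z' : MvPowerSeries (ℕ ⊕ ℕ) ℤ),
      tensorPairing (Z + Z') f g = tensorPairing Z f g + tensorPairing Z' f g :=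
    fun f g => (tensorPairingHom f g).map_add
  have hzero : ∀ f g : YoungDiagram →₀ ℤ, tensorPairing 0 f g = 0 :=
    fun f g => (tensorPairingHom f g).map_zero
  have hsmul : ∀ (f g : YoungDiagram →₀ ℤ) (c : ℤ) (Z : MvPowerSeries (ℕ ⊕ ℕ) ℤ),
      tensorPairing (c • Z) f g = c * tensorPairing Z f g :=
    fun f g => map_zsmul_eq_mul (tensorPairingHom f g)
  refine Submodule.span_induction (fun Z h => ?_) ?_ (fun Z Z' _ _ h h' => ?_)
    (fun c Z _ h => ?_) hZ'
  · obtain ⟨u, hu, w, hw, rfl⟩ := h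
    simp only [Set.mem_ofPred_eq]
    rw [tensor_mul_tensor, tensorPairing_tensor, tensorPairing_tensor, pairing_skew hu,
      pairing_skew hw]
  · simp only [Set.mem_ofPred_eq]
    rw [mul_zero, hzero, hzero]
  · simp only [Set.mem_ofPred_eq] at h h' ⊢
    rw [mul_add, hadd, hadd, h, h']
  · simp only [Set.mem_ofPred_eq] at h ⊢
    rw [Algebra.mul_smul_comm]
    exact (hsmul _ _ _ _).trans ((congrArg (c * ·) h).trans (hsmul _ _ _ _).symm)

/-! ### Universal characters -/

theorem skewSchur_eq (v l : YoungDiagram) :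
    skewSchur v l = schurComb (skew (schur l) (Finsupp.single v 1)) := by
  rw [schurComb_eq_finsum, skewSchur]
  refine finsum_congr fun m => ?_
  rw [lrCoeff, skew_single_apply, schurCoeff_eq
    (mul_mem (schur_mem_symmetricSeries l) (schur_mem_symmetricSeries m))]

theorem skewBy_eq {X : MvPowerSeries ℕ ℤ} (hX : X ∈ symmetricSeries) (l : YoungDiagram) :
    skewBy l X = schurComb (skew X (Finsupp.single l 1)) := by
  have hA : ∀ s ∉ (finite_weight_le (weight l)).toFinset,
      skew (schur s) (Finsupp.single l 1) = 0 := fun s hs => by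
    rw [Set.Finite.mem_toFinset] at hs
    exact skew_schur_single_eq_zero (not_le.1 hs)
  have h1 : skew X (Finsupp.single l 1) = ∑ s ∈ (finite_weight_le (weight l)).toFinset,
      schurFunctional s X • skew (schur s) (Finsupp.single l 1) := by
    ext m
    rw [skew_single_apply, Finsupp.finsetSum_apply]
    have h2 := map_eq_sum_of_hasSum
      (φ := (schurFunctional l).toAddMonoidHom.comp (AddMonoidHom.mulRight (schur m)))
      ((continuous_schurFunctional l).comp (continuous_id.mul continuous_const))
      (hasSum_schurFunctional hX) (finite_weight_le (weight l)).toFinset fun s hs => by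
        have := DFunLike.congr_fun (hA s hs) m
        rwa [skew_single_apply] at this
    refine h2.trans (Finset.sum_congr rfl fun s _ => ?_)
    rw [Finsupp.smul_apply, skew_single_apply]
    rfl
  rw [h1, map_sum, skewBy]
  refine (finsum_eq_sum_of_support_subset _ fun s hs => ?_).trans
    (Finset.sum_congr rfl fun s _ => ?_)
  · by_contra h
    rw [Function.mem_support, skewSchur_eq, hA s h, map_zero, smul_zero] at hs
    exact hs rfl
  · rw [map_zsmul, skewSchur_eq, schurCoeff_eq hX]

theorem univCharLin_schurComb {S : MvPowerSeries ℕ ℤ} (hS : S ∈ symmetricSeries)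
    (h : YoungDiagram →₀ ℤ) : univCharLin S (schurComb h) = schurComb (skew S h) := by
  have h1 : skew S h = ∑ v ∈ h.support, h v • skew S (Finsupp.single v 1) := by
    conv_lhs => rw [← h.sum_single, Finsupp.sum, map_sum]
    refine Finset.sum_congr rfl fun v _ => ?_
    rw [← map_zsmul, Finsupp.smul_single, smul_eq_mul, mul_one]
  rw [h1, map_sum, univCharLin]
  refine (finsum_eq_sum_of_support_subset _ fun v hv => ?_).trans
    (Finset.sum_congr rfl fun v _ => ?_)
  · rw [Finset.mem_coe, Finsupp.mem_support_iff]
    intro h0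
    rw [Function.mem_support, schurCoeff_eq (schurComb_mem_symmetricSeries h),
      schurFunctional_schurComb, h0, zero_smul] at hv
    exact hv rfl
  · rw [map_zsmul, univChar, skewBy_eq hS, schurCoeff_eq (schurComb_mem_symmetricSeries h),
      schurFunctional_schurComb]

/-- The product of `f/S` and `g/S`, after skewing by the inverse `T` of `S`. The sum is finite:
`A` contains every pair `(σ, τ)` for which the term in `D` contributes. -/
theorem skew_combMul_skew {S T : MvPowerSeries ℕ ℤ} (hT : T ∈ symmetricSeries) (hST : S * T = 1)
    {b : YoungDiagram → YoungDiagram → ℤ} {D : MvPowerSeries (ℕ ⊕ ℕ) ℤ}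
    (hD : HasSum (fun p : YoungDiagram × YoungDiagram =>
      b p.1 p.2 • tensor (schur p.1) (schur p.2)) D)
    (hΔ : coproduct T = tensor T T * D) (f g : YoungDiagram →₀ ℤ)
    (A : Finset (YoungDiagram × YoungDiagram))
    (hA : ∀ p ∉ A, skew (schur p.1) f = 0 ∨ skew (schur p.2) g = 0) :
    skew T (combMul (skew S f) (skew S g)) =
      ∑ p ∈ A, b p.1 p.2 • combMul (skew (schur p.1) f) (skew (schur p.2) g) := by
  refine ext_pairing fun Y hY => ?_
  have hY' := coproduct_mem_bisymmetricSeries hY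
  have hD' : D ∈ bisymmetricSeries := by
    refine mem_of_hasSum (p := Subalgebra.toSubmodule bisymmetricSeries)
      isClosed_bisymmetricSeries (fun p => ?_) hD
    exact zsmul_mem (S := Subalgebra ℤ (MvPowerSeries (ℕ ⊕ ℕ) ℤ)) (tensor_mem_bisymmetricSeries
      (schur_mem_symmetricSeries p.1) (schur_mem_symmetricSeries p.2)) _
  have hcop : coproduct (T * Y) = tensor T T * (D * coproduct Y) := by
    rw [← mul_assoc, ← hΔ]
    exact map_mul (renameEquiv ℤ Equiv.natSumNatEquivNat.symm) T Y
  have hterm : ∀ p : YoungDiagram × YoungDiagram,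
      tensorPairing (tensor (schur p.1) (schur p.2) * coproduct Y) f g =
        pairing Y (combMul (skew (schur p.1) f) (skew (schur p.2) g)) := fun p => by
    rw [tensorPairing_tensor_mul hY', pairing_combMul hY]
  have hsum := map_eq_sum_of_hasSum
    (φ := (tensorPairingHom f g).comp (AddMonoidHom.mulRight (coproduct Y)))
    ((continuous_tensorPairing f g).comp (continuous_id.mul continuous_const)) hD A fun p hp => by
      refine (hterm p).trans ?_
      rcases hA p hp with h | h
      · rw [h, map_zero, LinearMap.zero_apply, map_zero]
      · rw [h, map_zero, map_zero]
  have hcancel : tensor S S * (tensor T T * (D * coproduct Y)) = D * coproduct Y := by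
    rw [← mul_assoc, tensor_mul_tensor, hST, tensor_one_one, one_mul]
  have hmem : tensor T T * (D * coproduct Y) ∈ bisymmetricSeries :=
    mul_mem (tensor_mem_bisymmetricSeries hT hT) (mul_mem hD' hY')
  rw [pairing_skew hY, pairing_combMul (mul_mem hT hY), hcop, ← tensorPairing_tensor_mul hmem,
    hcancel, map_sum]
  refine hsum.trans (Finset.sum_congr rfl fun p _ => ?_)
  rw [map_zsmul_eq_mul]
  exact congrArg _ (hterm p)

end SymmFn

theorem theorem3
    (S T : MvPowerSeries ℕ ℤ) (hS : SymmFn.IsSchurSeries S) (hT : SymmFn.IsSchurSeries T)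
    (hST : S * T = 1)
    (b : YoungDiagram → YoungDiagram → ℤ) (D : MvPowerSeries (ℕ ⊕ ℕ) ℤ)
    (hD : HasSum (fun p : YoungDiagram × YoungDiagram =>
      b p.1 p.2 • SymmFn.tensor (SymmFn.schur p.1) (SymmFn.schur p.2)) D)
    (hΔ : SymmFn.coproduct T = SymmFn.tensor T T * D)
    (l m : YoungDiagram) :
    (Function.support fun p : YoungDiagram × YoungDiagram =>
      b p.1 p.2 • SymmFn.univCharLin S (SymmFn.skewSchur l p.1 * SymmFn.skewSchur m p.2)).Finite ∧
    SymmFn.univChar S l * SymmFn.univChar S m =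
      ∑ᶠ p : YoungDiagram × YoungDiagram,
        b p.1 p.2 • SymmFn.univCharLin S
          (SymmFn.skewSchur l p.1 * SymmFn.skewSchur m p.2) := by
  replace hS := hS.mem_symmetricSeries
  replace hT := hT.mem_symmetricSeries
  -- `s_{l/σ} = 0` when `|l| < |σ|`, so only the pairs in `A` contribute
  set f : YoungDiagram →₀ ℤ := Finsupp.single l 1 with hf
  set g : YoungDiagram →₀ ℤ := Finsupp.single m 1 with hg
  let A : Finset (YoungDiagram × YoungDiagram) :=
    (SymmFn.finite_weight_le (SymmFn.weight l)).toFinset ×ˢ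
      (SymmFn.finite_weight_le (SymmFn.weight m)).toFinset
  have hA : ∀ p ∉ A, SymmFn.skew (SymmFn.schur p.1) f = 0 ∨
      SymmFn.skew (SymmFn.schur p.2) g = 0 := by
    intro p hp
    rw [Finset.mem_product, Set.Finite.mem_toFinset, Set.Finite.mem_toFinset, not_and_or] at hp
    exact hp.imp (fun h => SymmFn.skew_schur_single_eq_zero (not_le.1 h))
      fun h => SymmFn.skew_schur_single_eq_zero (not_le.1 h)
  have hterm : ∀ p : YoungDiagram × YoungDiagram,
      SymmFn.univCharLin S (SymmFn.skewSchur l p.1 * SymmFn.skewSchur m p.2) =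
        SymmFn.schurComb (SymmFn.skew S (SymmFn.combMul (SymmFn.skew (SymmFn.schur p.1) f)
          (SymmFn.skew (SymmFn.schur p.2) g))) := fun p => by
    rw [SymmFn.skewSchur_eq, SymmFn.skewSchur_eq, ← SymmFn.schurComb_combMul,
      SymmFn.univCharLin_schurComb hS]
  have hsupp : (Function.support fun p : YoungDiagram × YoungDiagram =>
      b p.1 p.2 • SymmFn.univCharLin S
        (SymmFn.skewSchur l p.1 * SymmFn.skewSchur m p.2)) ⊆ A := by
    intro p hp
    by_contra h
    rw [Function.mem_support, hterm] at hp
    apply hp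
    rcases hA p h with h | h
    · rw [h, map_zero, LinearMap.zero_apply, map_zero, map_zero, smul_zero]
    · rw [h, map_zero, map_zero, map_zero, smul_zero]
  refine ⟨A.finite_toSet.subset hsupp, ?_⟩
  rw [finsum_eq_sum_of_support_subset _ hsupp, SymmFn.univChar, SymmFn.univChar,
    SymmFn.skewBy_eq hS, SymmFn.skewBy_eq hS, ← SymmFn.schurComb_combMul]
  have h1 := congrArg (SymmFn.skew S) (SymmFn.skew_combMul_skew hT hST hD hΔ f g A hA)
  rw [SymmFn.skew_skew _ hS, mul_comm T S, hST, SymmFn.skew_one] at h1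
  rw [h1, map_sum, map_sum]
  refine Finset.sum_congr rfl fun p _ => ?_
  rw [map_zsmul, map_zsmul, hterm]
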